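/- Let $S$ be an undirected graph on $q$ nodes $u_1,\dots,u_q$, possibly with self-loops, with edges $f_1,\dots,f_m$, and let $x=(x_1,\dots,x_q)$ be a vector of positive integers. For an edge $f_j=\{u_k,u_\ell\}$ (possibly $u_k=u_\ell$) let $z_j:=\tfrac12(e_k+e_\ell)\in\mathbb R^q$ be its incidence vector, and let $\mathsf X:=\{\sum_{j=1}^m c_jz_j \mid c_j\ge 0\}$ be the convex cone generated by the incidence vectors. Consider the linear program $$\max\ \mathbf 1^{\top}y\quad\text{s.t.}\quad y\in\mathsf X\ \text{ and }\ y\le x \ \text{ (entrywise)},\qquad (\ast)$$ and let $\mathsf Y_x$ be its set of (optimal) solutions; an extremal solution is a vertex (extreme point) of $\mathsf Y_x$. For $y\in\mathbb N_0^q$ let $K_y$ be the complete $S$-partite graph with exactly $y_i$ nodes over $u_i$, i.e. the graph with nodes $(i,a)$, $1\le i\le q$, $1\le a\le y_i$, in which two distinct nodes $(i,a)$, $(j,b)$ are adjacent if and only if $\{u_i,u_j\}$ is an edge of $S$. If $y\le x$, then $K_y$ is regarded as a subgraph of $K_x$ in the obvious way. A subgraph is 2-regular if it is a node-disjoint union of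 (possibly zero) cycles, where a cycle has at least three nodes; a cycle cover of a graph is a 2-regular subgraph that contains all of its nodes. Then the following hold. 1. Every extremal solution of $(\ast)$ is integer valued. 2. An integer solution of $(\ast)$ can be computed in time $O(q^3)$. Precisely: there is a single random access machine program that, for all $q\ge 1$, all $S$ and all $x$ as above, given $q$, the adjacency matrix of $S$ and the vector $x$, halts after at most $Cq^3$ steps, with $C$ independent of $q$, $S$ and $x$, and outputs an integer vector in $\mathsf Y_x$. Each arithmetic operation $(+,-,\times,\div)$, comparison, memory access and branch counts as one step, and the machine words have $O(\log(q+\sum_i x_i))$ bits. 3. Suppose that $x_i\ge 3$ for all $i$. Then, for every integer solution $y$ of $(\ast)$, the graph $K_y$ has a cycle cover with at most $q$ cycles. Moreover, every cycle cover of $K_y$ is, as a subgraph of $K_x$, a 2-regular subgraph of $K_x$ with the largest possible number of nodes. -/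

import Mathlib

/-! ### Graphs with self-loops, the edge cone and the linear program -/

/-- An undirected graph on the node set `V`, possibly with self-loops (and without multiple
edges): a finite set of unordered pairs, the pair `s(u, u)` being a self-loop at `u`. -/
structure LoopGraph (V : Type*) where
  /-- the edge set -/
  edges : Finset (Sym2 V)

namespace LoopGraph

variable {q : ℕ}

/-- The incidence vector `(e_k + e_l) / 2` of the unordered pair `s(k, l)`. -/
noncomputable def incVec (f : Sym2 (Fin q)) : Fin q → ℝ :=
  Sym2.lift ⟨fun k l => (1 / 2 : ℝ) • (Pi.single k 1 + Pi.single l 1),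
    fun _ _ => congrArg ((1 / 2 : ℝ) • ·) (add_comm _ _)⟩ f

/-- The incidence matrix `Z` of `S`: its columns are the incidence vectors of the edges. -/
noncomputable def incMatrix (S : LoopGraph (Fin q)) :
    Matrix (Fin q) {f // f ∈ S.edges} ℝ :=
  Matrix.of fun i f => incVec f.1 i

/-- The convex cone generated by the incidence vectors of the edges of `S`. -/
def edgeCone (S : LoopGraph (Fin q)) : Set (Fin q → ℝ) :=
  {y | ∃ c : {f // f ∈ S.edges} → ℝ, (∀ f, 0 ≤ c f) ∧ y = S.incMatrix.mulVec c}

/-- The feasible set of the linear program: `y` in the edge cone, `y ≤ x`. -/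
def lpFeasible (S : LoopGraph (Fin q)) (x : Fin q → ℕ) : Set (Fin q → ℝ) :=
  {y | y ∈ S.edgeCone ∧ ∀ i, y i ≤ (x i : ℝ)}

/-- The set of (optimal) solutions of the linear program `max 1ᵀy`, `y` feasible. -/
def lpSolutions (S : LoopGraph (Fin q)) (x : Fin q → ℕ) : Set (Fin q → ℝ) :=
  {y | y ∈ S.lpFeasible x ∧ ∀ y' ∈ S.lpFeasible x, ∑ i, y' i ≤ ∑ i, y i}

/-- A solution lies below `x`. -/
theorem le_of_mem_lpSolutions {S : LoopGraph (Fin q)} {x y : Fin q → ℕ}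
    (h : (fun i => (y i : ℝ)) ∈ S.lpSolutions x) (i : Fin q) : y i ≤ x i := by
  have h' : (y i : ℝ) ≤ (x i : ℝ) := h.1.2 i
  exact_mod_cast h'

/-! ### Complete `S`-partite graphs -/

/-- The complete `S`-partite graph `K_x` with exactly `x i` nodes over the node `i` of `S`. The
projection to `S` is `Sigma.fst`; two distinct nodes are adjacent iff their projections form an
edge of `S`. Cycles have at least three nodes and never use self-loops, so `K_x` is taken
without self-loops. -/
def completePartite (S : LoopGraph (Fin q)) (x : Fin q → ℕ) :
    SimpleGraph (Σ i : Fin q, Fin (x i)) where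
  Adj v w := v ≠ w ∧ s(v.1, w.1) ∈ S.edges
  symm := ⟨fun v w h => ⟨h.1.symm, by rw [Sym2.eq_swap]; exact h.2⟩⟩
  loopless := ⟨fun _ h => h.1 rfl⟩

/-- For `y ≤ x`, the inclusion of `K_y` in `K_x`, compatible with the projections to `S`. -/
def inclusion (S : LoopGraph (Fin q)) {y x : Fin q → ℕ} (h : ∀ i, y i ≤ x i) :
    S.completePartite y →g S.completePartite x where
  toFun v := ⟨v.1, Fin.castLE (h v.1) v.2⟩
  map_rel' := by
    rintro ⟨i, a⟩ ⟨j, b⟩ ⟨hne, hadj⟩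
    refine ⟨fun heq => hne ?_, hadj⟩
    obtain ⟨rfl, h2⟩ := Sigma.mk.inj_iff.mp heq
    have h3 : a = b := Fin.castLE_injective (h i) (eq_of_heq h2)
    rw [h3]

end LoopGraph

/-! ### 2-regular subgraphs and cycle covers -/

namespace SimpleGraph.Subgraph

variable {V : Type*} {G : SimpleGraph V}

/-- `C` is a cycle of `G` (a subgraph traced by a closed walk that repeats no edge and no node
except for its end; it has at least three nodes). -/
def IsCycleGraph (C : G.Subgraph) : Prop :=
  ∃ (v : V) (p : G.Walk v v), p.IsCycle ∧ p.toSubgraph = C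

/-- `H` is the union of `k` pairwise node-disjoint cycles. -/
def IsDisjointUnionOfCycles (H : G.Subgraph) (k : ℕ) : Prop :=
  ∃ C : Fin k → G.Subgraph, (∀ a, (C a).IsCycleGraph) ∧
    (∀ a b, a ≠ b → Disjoint (C a).verts (C b).verts) ∧ H = ⨆ a, C a

/-- `H` is 2-regular: a node-disjoint union of (finitely many, possibly no) cycles. -/
def IsTwoRegular (H : G.Subgraph) : Prop :=
  ∃ k, H.IsDisjointUnionOfCycles k

/-- `H` is a 2-regular subgraph of `G` with the largest possible number of nodes. -/
def IsLargestTwoRegular (H : G.Subgraph) : Prop :=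
  H.IsTwoRegular ∧ ∀ H' : G.Subgraph, H'.IsTwoRegular → H'.verts.ncard ≤ H.verts.ncard

end SimpleGraph.Subgraph

/-! ### Random access machine with a step count

Programs are structured programs over finitely many arrays of natural numbers (a scalar
variable is the cell `0` of an array); every operation, memory access and test costs one step.
The machine has words that hold the numbers `0, …, B`: a program gets stuck as soon as it
produces a larger number. -/

namespace Ram

/-- The operations of the machine. -/
inductive Op
  | add | sub | mul | div | lt | eq

/-- Subtraction is truncated, division is rounded down (division by `0` gives `0`), and tests
have value `0` or `1`. -/
def Op.eval : Op → ℕ → ℕ → ℕ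
  | .add, m, n => m + n
  | .sub, m, n => m - n
  | .mul, m, n => m * n
  | .div, m, n => m / n
  | .lt, m, n => if m < n then 1 else 0
  | .eq, m, n => if m = n then 1 else 0

/-- Expressions: constants, the cell of a given array at a computed index, operations. -/
inductive Term
  | const (n : ℕ)
  | read (a : ℕ) (i : Term)
  | op (o : Op) (e₁ e₂ : Term)

/-- Programs. `set a i e` writes the value of `e` to cell `i` of array `a`; `cond` and `loop`
branch on whether the value of an expression is nonzero. -/
inductive Cmd
  | skip
  | set (a : ℕ) (i e : Term)
  | seq (c₁ c₂ : Cmd)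
  | cond (e : Term) (c₁ c₂ : Cmd)
  | loop (e : Term) (c : Cmd)

/-- A memory: the content of each cell of each array. -/
abbrev Mem := ℕ → ℕ → ℕ

/-- Write `v` to cell `i` of array `a`. -/
def Mem.write (s : Mem) (a i v : ℕ) : Mem :=
  Function.update s a (Function.update (s a) i v)

/-- The value of an expression. -/
def Term.eval (s : Mem) : Term → ℕ
  | .const n => n
  | .read a i => s a (i.eval s)
  | .op o e₁ e₂ => o.eval (e₁.eval s) (e₂.eval s)

/-- The number of steps for the evaluation of an expression. -/
def Term.cost : Term → ℕ
  | .const _ => 1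
  | .read _ i => i.cost + 1
  | .op _ e₁ e₂ => e₁.cost + e₂.cost + 1

/-- All numbers that occur in the evaluation of an expression are at most `B`. -/
def Term.Fits (B : ℕ) (s : Mem) : Term → Prop
  | .const n => n ≤ B
  | .read a i => i.Fits B s ∧ s a (i.eval s) ≤ B
  | .op o e₁ e₂ => e₁.Fits B s ∧ e₂.Fits B s ∧ o.eval (e₁.eval s) (e₂.eval s) ≤ B

/-- `Runs B c s t s'`: on a machine whose words hold the numbers up to `B`, the program `c`
started in memory `s` halts after exactly `t` steps in memory `s'`. -/
inductive Runs (B : ℕ) : Cmd → Mem → ℕ → Mem → Prop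
  | skip (s : Mem) : Runs B .skip s 1 s
  | set (a : ℕ) (i e : Term) (s : Mem) (hi : i.Fits B s) (he : e.Fits B s) :
      Runs B (.set a i e) s (i.cost + e.cost + 1) (s.write a (i.eval s) (e.eval s))
  | seq (c₁ c₂ : Cmd) (s s' s'' : Mem) (t₁ t₂ : ℕ) (h₁ : Runs B c₁ s t₁ s')
      (h₂ : Runs B c₂ s' t₂ s'') : Runs B (.seq c₁ c₂) s (t₁ + t₂) s''
  | cond_true (e : Term) (c₁ c₂ : Cmd) (s s' : Mem) (t : ℕ) (he : e.Fits B s)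
      (hv : e.eval s ≠ 0) (h : Runs B c₁ s t s') :
      Runs B (.cond e c₁ c₂) s (e.cost + 1 + t) s'
  | cond_false (e : Term) (c₁ c₂ : Cmd) (s s' : Mem) (t : ℕ) (he : e.Fits B s)
      (hv : e.eval s = 0) (h : Runs B c₂ s t s') :
      Runs B (.cond e c₁ c₂) s (e.cost + 1 + t) s'
  | loop_done (e : Term) (c : Cmd) (s : Mem) (he : e.Fits B s) (hv : e.eval s = 0) :
      Runs B (.loop e c) s (e.cost + 1) s
  | loop_step (e : Term) (c : Cmd) (s s' s'' : Mem) (t₁ t₂ : ℕ) (he : e.Fits B s)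
      (hv : e.eval s ≠ 0) (h₁ : Runs B c s t₁ s') (h₂ : Runs B (.loop e c) s' t₂ s'') :
      Runs B (.loop e c) s (e.cost + 1 + t₁ + t₂) s''

/-- The input memory for a graph `S` on `q` nodes and a vector `x`: the number `q` in cell `0` of
array `0`, the `q × q` adjacency matrix of `S` row by row in array `1`, the entries of `x` in
array `2`, and zeros everywhere else. -/
def input {q : ℕ} (S : LoopGraph (Fin q)) (x : Fin q → ℕ) : Mem
  | 0, n => if n = 0 then q else 0
  | 1, n => if ∃ i j : Fin q, n = i * q + j ∧ s(i, j) ∈ S.edges then 1 else 0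
  | 2, n => if h : n < q then x ⟨n, h⟩ else 0
  | _, _ => 0

/-- The output vector in `ℕ^q`: the first `q` cells of array `3`. -/
def output (q : ℕ) (s : Mem) : Fin q → ℕ := fun i => s 3 i

end Ram

/-!
The linear program is a flow problem. A vector `y` lies in the edge cone iff it is the throughput
of a circulation on the symmetric digraph of `S` (`LoopGraph.mem_edgeCone_iff`).

*Integrality.* The solution set is therefore the image of a polytope of circulations with integral
node capacities, and an extreme solution is the throughput of an extreme circulation. If that one
were not integral, then, after splitting the nodes, its non-integral arcs would form a subgraph of
minimum degree two, which supports a nonzero circulation (`exists_ne_zero_conserved_of_not_int`)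
along which the extreme point could be moved in both directions.

*Algorithm.* Let `φ` be a maximum flow, with row and column sums at most `x`, in the bipartite
double cover of `S`. Its row sums `y` already solve the linear program
(`LoopGraph.mem_lpSolutions_of_flow`): for a set `I` of nodes with neighbourhood `J`, using `φ` for
the rows in `I` and the transpose of `φ` for the other rows, restricted to the columns outside of
`J`, gives a flow of value `y(I) + y(Jᶜ)`, so `y(I) ≤ y(J)` by maximality; by Hall's theorem, `y` is
the throughput of an integral circulation. No symmetrization, hence no rounding, is needed. A
maximum flow is found by push-relabel with current arcs, where the nodes are visited in passes; a
potential of size `O(q ^ 3)` drops in each elementary step (`PushState.Inv.step_potential`). Since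
all data start from zero, the program is a single loop that makes `60 * q ^ 3` elementary steps,
which idle once no node is active.

*Cycle covers.* For an integral `y` in the edge cone, Hall's theorem gives a permutation of the nodes
of `K_y` that moves along the edges of `S`. Two cycles of the permutation that meet the same fibre
of `K_y → S` can be merged by a transposition, so a permutation with the fewest cycles has at most
`q` of them. Optimality saturates an endpoint of each edge of `S`
(`LoopGraph.eq_or_eq_of_mem_lpSolutions`), so that each cycle contains a whole fibre of at least
three nodes, and is a cycle of the graph. Conversely, the numbers of nodes of a 2-regular
subgraph of `K_x` over the nodes of `S` form a feasible vector (`LoopGraph.sum_verts_mem_edgeCone`),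
so no 2-regular subgraph has more nodes than `K_y`.
-/

/-! ### Circulations -/

namespace LoopGraph

variable {q : ℕ}

theorem incVec_mk (k l i : Fin q) :
    incVec s(k, l) i = ((if i = k then 1 else 0) + (if i = l then 1 else 0)) / 2 := by
  simp only [incVec, Sym2.lift_mk, Pi.smul_apply, Pi.add_apply, Pi.single_apply, smul_eq_mul]
  ring

theorem zero_mem_edgeCone (S : LoopGraph (Fin q)) : (0 : Fin q → ℝ) ∈ S.edgeCone :=
  ⟨0, fun _ => le_rfl, by simp⟩

theorem add_mem_edgeCone {S : LoopGraph (Fin q)} {y z : Fin q → ℝ} (hy : y ∈ S.edgeCone)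
    (hz : z ∈ S.edgeCone) : y + z ∈ S.edgeCone := by
  obtain ⟨c, hc, rfl⟩ := hy
  obtain ⟨d, hd, rfl⟩ := hz
  exact ⟨c + d, fun f => add_nonneg (hc f) (hd f), by rw [Matrix.mulVec_add]⟩

theorem smul_incVec_mem_edgeCone {S : LoopGraph (Fin q)} {f : Sym2 (Fin q)} (hf : f ∈ S.edges)
    {r : ℝ} (hr : 0 ≤ r) : r • incVec f ∈ S.edgeCone := by
  classical
  refine ⟨Pi.single ⟨f, hf⟩ r, fun g => ?_, ?_⟩
  · by_cases h : g = ⟨f, hf⟩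
    · subst h; simpa using hr
    · simp [h]
  · ext i
    simp [incMatrix, mul_comm]

theorem sum_mem_edgeCone {S : LoopGraph (Fin q)} {ι : Type*} (t : Finset ι) (y : ι → Fin q → ℝ)
    (h : ∀ a ∈ t, y a ∈ S.edgeCone) : ∑ a ∈ t, y a ∈ S.edgeCone :=
  Finset.sum_induction _ (· ∈ S.edgeCone) (fun _ _ => add_mem_edgeCone) (zero_mem_edgeCone S) h

/-- A circulation on the symmetric digraph of `S` (an arc `i → j` and an arc `j → i` for every
edge `s(i, j)`) that has throughput `y i` at the node `i`. -/
structure IsCirculation (S : LoopGraph (Fin q)) (y : Fin q → ℝ) (φ : Fin q × Fin q → ℝ) :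
    Prop where
  nonneg : ∀ a, 0 ≤ φ a
  supp : ∀ i j, s(i, j) ∉ S.edges → φ (i, j) = 0
  row : ∀ i, ∑ j, φ (i, j) = y i
  col : ∀ j, ∑ i, φ (i, j) = y j

/-- Spreading the weight of an edge evenly over its two orientations gives a circulation. -/
theorem exists_isCirculation_incVec {S : LoopGraph (Fin q)} (f : {f // f ∈ S.edges}) :
    ∃ ψ, S.IsCirculation (incVec f.1) ψ := by
  obtain ⟨f, hf⟩ := f
  induction f with
  | _ k l =>
    refine ⟨fun a => ((if a.1 = k then 1 else 0) * (if a.2 = l then 1 else 0) +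
      (if a.1 = l then 1 else 0) * (if a.2 = k then 1 else 0)) / 2, fun a => ?_, fun i j h => ?_,
      fun i => ?_, fun j => ?_⟩
    · split_ifs <;> norm_num
    · have h1 : ¬ (i = k ∧ j = l) := by rintro ⟨rfl, rfl⟩; exact h hf
      have h2 : ¬ (i = l ∧ j = k) := by rintro ⟨rfl, rfl⟩; exact h (Sym2.eq_swap ▸ hf)
      simp only [mul_ite, mul_one, mul_zero]
      split_ifs <;> simp_all
    · simp [← Finset.sum_div, Finset.sum_add_distrib, incVec_mk]
    · simp [← Finset.sum_div, Finset.sum_add_distrib, incVec_mk, add_comm]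

theorem mem_edgeCone_iff {S : LoopGraph (Fin q)} {y : Fin q → ℝ} :
    y ∈ S.edgeCone ↔ ∃ φ, S.IsCirculation y φ := by
  constructor
  · rintro ⟨c, hc, rfl⟩
    choose ψ hψ using fun f => exists_isCirculation_incVec (S := S) f
    refine ⟨fun a => ∑ f, ψ f a * c f, fun a => ?_, fun i j h => ?_, fun i => ?_, fun j => ?_⟩
    · exact Finset.sum_nonneg fun f _ => mul_nonneg ((hψ f).nonneg a) (hc f)
    · exact Finset.sum_eq_zero fun f _ => by rw [(hψ f).supp i j h, zero_mul]
    · rw [Finset.sum_comm]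
      simp only [← Finset.sum_mul, (hψ _).row]
      rfl
    · rw [Finset.sum_comm]
      simp only [← Finset.sum_mul, (hψ _).col]
      rfl
  · rintro ⟨φ, h⟩
    have hy : y = ∑ a : Fin q × Fin q, φ a • incVec s(a.1, a.2) := by
      ext i
      rw [Finset.sum_apply, Fintype.sum_prod_type]
      simp only [Pi.smul_apply, smul_eq_mul, incVec_mk, mul_div_assoc', ← Finset.sum_div, mul_add,
        Finset.sum_add_distrib, mul_ite, mul_one, mul_zero]
      have h1 : ∑ k, ∑ l, (if i = k then φ (k, l) else 0) = y i := by
        rw [Finset.sum_comm]; simpa using h.row i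
      have h2 : ∑ k, ∑ l, (if i = l then φ (k, l) else 0) = y i := by
        simpa using h.col i
      rw [h1, h2]
      ring
    rw [hy]
    refine sum_mem_edgeCone _ _ fun a _ => ?_
    by_cases ha : s(a.1, a.2) ∈ S.edges
    · exact smul_incVec_mem_edgeCone ha (h.nonneg a)
    · rw [h.supp _ _ ha, zero_smul]
      exact zero_mem_edgeCone S

/-- What leaves `A` arrives in the neighbourhood of `A`. -/
theorem sum_le_sum_of_mem_edgeCone {S : LoopGraph (Fin q)} {y : Fin q → ℝ} (hy : y ∈ S.edgeCone)
    {A B : Finset (Fin q)} (h : ∀ i ∈ A, ∀ j, s(i, j) ∈ S.edges → j ∈ B) :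
    ∑ i ∈ A, y i ≤ ∑ j ∈ B, y j := by
  obtain ⟨φ, hφ⟩ := mem_edgeCone_iff.1 hy
  calc ∑ i ∈ A, y i = ∑ i ∈ A, ∑ j ∈ B, φ (i, j) := by
        refine Finset.sum_congr rfl fun i hi => ?_
        rw [← hφ.row i]
        refine (Finset.sum_subset (Finset.subset_univ _) fun j _ hj => ?_).symm
        exact hφ.supp i j fun hij => hj (h i hi j hij)
    _ = ∑ j ∈ B, ∑ i ∈ A, φ (i, j) := Finset.sum_comm
    _ ≤ ∑ j ∈ B, y j := by
        refine Finset.sum_le_sum fun j _ => ?_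
        rw [← hφ.col j]
        exact Finset.sum_le_sum_of_subset_of_nonneg (Finset.subset_univ _) fun i _ _ => hφ.nonneg _

end LoopGraph

/-! ### Integrality of extreme circulations -/

/-- The non-integral part of a real circulation with integral imbalances supports a nonzero
circulation: in the subgraph of the non-integral arcs every node has degree at least two, so
there are at least as many arcs as nodes, whereas the conservation laws, which sum to zero, have
smaller rank than the number of nodes. -/
theorem exists_ne_zero_conserved_of_not_int {E V : Type*} [Fintype E] [Fintype V]
    [DecidableEq V] (tail head : E → V) (hne : ∀ e, tail e ≠ head e) (f : E → ℝ)
    (hf : ∀ v, ∑ e with tail e = v, f e = ∑ e with head e = v, f e)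
    (hint : ∃ e, ∀ n : ℤ, f e ≠ n) :
    ∃ δ : E → ℝ, δ ≠ 0 ∧ (∀ e (n : ℤ), f e = n → δ e = 0) ∧
      ∀ v, ∑ e with tail e = v, δ e = ∑ e with head e = v, δ e := by
  classical
  let E' := {e // ∀ n : ℤ, f e ≠ n}
  let V' := {v // ∃ e : E', tail e = v ∨ head e = v}
  -- extension of a function on the non-integral arcs by zero
  let ext : (E' → ℝ) →ₗ[ℝ] (E → ℝ) :=
    { toFun := fun δ e => if h : ∀ n : ℤ, f e ≠ n then δ ⟨e, h⟩ else 0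
      map_add' := by intro a b; ext e; by_cases h : ∀ n : ℤ, f e ≠ n <;> simp [h]
      map_smul' := by intro a b; ext e; by_cases h : ∀ n : ℤ, f e ≠ n <;> simp [h] }
  let T : (E' → ℝ) →ₗ[ℝ] (V' → ℝ) :=
    { toFun := fun δ v => ∑ e with tail e = v.1, ext δ e - ∑ e with head e = v.1, ext δ e
      map_add' := by
        intro a b; ext v
        simp only [map_add, Pi.add_apply, Finset.sum_add_distrib]; ring
      map_smul' := by
        intro a b; ext v
        simp only [map_smul, Pi.smul_apply, smul_eq_mul, ← Finset.mul_sum, RingHom.id_apply]; ring }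
  have hext0 : ∀ δ e, (¬ ∀ n : ℤ, f e ≠ n) → ext δ e = 0 := fun δ e h => by
    simp only [ext, LinearMap.coe_mk, AddHom.coe_mk, dif_neg h]
  have hext1 : ∀ δ (e : E'), ext δ e.1 = δ e := fun δ e => dif_pos e.2
  suffices h : ∃ δ, δ ≠ 0 ∧ T δ = 0 by
    obtain ⟨δ, h0, hT⟩ := h
    refine ⟨ext δ, fun h => h0 ?_, fun e n he => ?_, fun v => ?_⟩
    · ext e
      have := congrFun h e.1
      rw [hext1] at this
      exact this
    · exact hext0 δ e fun h => h n he
    · by_cases hv : ∃ e : E', tail e = v ∨ head e = v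
      · exact sub_eq_zero.1 (congrFun hT ⟨v, hv⟩)
      · push Not at hv
        rw [Finset.sum_eq_zero, Finset.sum_eq_zero]
        · intro e he
          exact hext0 δ e fun h => (hv ⟨e, h⟩).2 (Finset.mem_filter.1 he).2
        · intro e he
          exact hext0 δ e fun h => (hv ⟨e, h⟩).1 (Finset.mem_filter.1 he).2
  by_contra! hcon
  have hinj : Function.Injective T := by
    rw [← LinearMap.ker_eq_bot, LinearMap.ker_eq_bot']
    intro δ hδ
    by_contra h0
    exact hcon δ h0 hδ
  -- every node that meets a non-integral arc meets at least two of them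
  have hdeg : ∀ v : V', 2 ≤ ((Finset.univ : Finset E').filter
      fun e => tail e.1 = v.1 ∨ head e.1 = v.1).card := by
    rintro ⟨v, e₀, he₀⟩
    by_contra! hlt
    have huniq : ∀ e, (tail e = v ∨ head e = v) → e ≠ e₀.1 → ∃ n : ℤ, f e = n := by
      intro e he hee
      by_contra! hn
      have : ({⟨e, hn⟩, e₀} : Finset E').card ≤ ((Finset.univ : Finset E').filter
          fun e => tail e.1 = v ∨ head e.1 = v).card := by
        apply Finset.card_le_card
        intro a ha
        simp only [Finset.mem_insert, Finset.mem_singleton] at ha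
        rcases ha with rfl | rfl <;> simpa
      rw [Finset.card_pair (by intro h; exact hee (congrArg Subtype.val h))] at this
      exact absurd (this.trans_lt hlt) (lt_irrefl _)
    choose! g hg using huniq
    have hsum : ∀ s : Finset E, (∀ e ∈ s, tail e = v ∨ head e = v) → e₀.1 ∉ s →
        ∃ n : ℤ, ∑ e ∈ s, f e = n := by
      intro s hs hes
      refine ⟨∑ e ∈ s, g e, ?_⟩
      push_cast
      exact Finset.sum_congr rfl fun e he => hg e (hs e he) (by rintro rfl; exact hes he)
    have key : ∀ s t : Finset E, (∀ e ∈ s, tail e = v ∨ head e = v) →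
        (∀ e ∈ t, tail e = v ∨ head e = v) → e₀.1 ∈ s → e₀.1 ∉ t →
        ∑ e ∈ s, f e = ∑ e ∈ t, f e → False := by
      intro s t hs ht hes het h
      obtain ⟨n, hn⟩ := hsum (s.erase e₀.1) (fun e he => hs e (Finset.mem_of_mem_erase he))
        (Finset.notMem_erase _ _)
      obtain ⟨m, hm⟩ := hsum t ht het
      have := Finset.add_sum_erase s f hes
      refine e₀.2 (m - n) ?_
      push_cast
      linarith
    have hA : ∀ e ∈ Finset.univ.filter (fun e => tail e = v), tail e = v ∨ head e = v :=
      fun e he => Or.inl (Finset.mem_filter.1 he).2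
    have hB : ∀ e ∈ Finset.univ.filter (fun e => head e = v), tail e = v ∨ head e = v :=
      fun e he => Or.inr (Finset.mem_filter.1 he).2
    rcases he₀ with h0 | h0
    · refine key _ _ hA hB (by simpa using h0) ?_ (hf v)
      simp only [Finset.mem_filter, Finset.mem_univ, true_and]
      exact fun h => hne _ (h0.trans h.symm)
    · refine key _ _ hB hA (by simpa using h0) ?_ (hf v).symm
      simp only [Finset.mem_filter, Finset.mem_univ, true_and]
      exact fun h => hne _ (h.trans h0.symm)
  have hcard : Fintype.card V' ≤ Fintype.card E' := by
    have h1 : 2 * Fintype.card V' ≤ ∑ v : V', ((Finset.univ : Finset E').filter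
        fun e => tail e.1 = v.1 ∨ head e.1 = v.1).card := by
      rw [mul_comm, ← smul_eq_mul, ← Finset.card_univ]
      exact Finset.card_nsmul_le_sum _ _ _ fun v _ => hdeg v
    have h2 := Finset.sum_card_bipartiteAbove_eq_sum_card_bipartiteBelow
      (s := (Finset.univ : Finset V')) (t := (Finset.univ : Finset E'))
      (fun v e => tail e.1 = v.1 ∨ head e.1 = v.1)
    simp only [Finset.bipartiteAbove, Finset.bipartiteBelow] at h2
    rw [h2] at h1
    have h3 : ∀ e ∈ (Finset.univ : Finset E'), ((Finset.univ : Finset V').filter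
        fun v => tail e.1 = v.1 ∨ head e.1 = v.1).card ≤ 2 := by
      intro e _
      calc _ ≤ ({⟨tail e.1, e, Or.inl rfl⟩, ⟨head e.1, e, Or.inr rfl⟩} : Finset V').card := by
            apply Finset.card_le_card
            intro v hv
            simp only [Finset.mem_filter, Finset.mem_univ, true_and] at hv
            simp only [Finset.mem_insert, Finset.mem_singleton]
            rcases hv with h | h
            · exact Or.inl (Subtype.ext h.symm)
            · exact Or.inr (Subtype.ext h.symm)
        _ ≤ 2 := Finset.card_le_two
    have h4 := Finset.sum_le_card_nsmul _ _ _ h3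
    rw [smul_eq_mul, Finset.card_univ] at h4
    omega
  have hcard' : Fintype.card E' = Fintype.card V' := by
    have := LinearMap.finrank_le_finrank_of_injective hinj
    simp only [Module.finrank_fintype_fun_eq_card] at this
    omega
  have hsurj : Function.Surjective T := by
    refine (LinearMap.injective_iff_surjective_of_finrank_eq_finrank ?_).1 hinj
    simp only [Module.finrank_fintype_fun_eq_card, hcard']
  obtain ⟨e₁, he₁⟩ := hint
  obtain ⟨δ, hδ⟩ := hsurj (fun _ => 1)
  -- the conservation laws sum to zero
  have hzero : ∑ v : V', T δ v = 0 := by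
    have hcol : ∀ r : E → V, (∀ e : E', ∃ e' : E', tail e' = r e ∨ head e' = r e) →
        ∑ v : V', ∑ e with r e = v.1, ext δ e = ∑ e, ext δ e := by
      intro r hr
      simp only [Finset.sum_filter]
      rw [Finset.sum_comm]
      refine Finset.sum_congr rfl fun e _ => ?_
      by_cases he : ∀ n : ℤ, f e ≠ n
      · rw [Finset.sum_eq_single (⟨r e, hr ⟨e, he⟩⟩ : V')]
        · simp
        · intro v _ hv
          rw [if_neg]
          rintro h
          exact hv (Subtype.ext h.symm)
        · simp
      · simp [hext0 δ e he]
    have hT : ∀ v, T δ v = ∑ e with tail e = v.1, ext δ e - ∑ e with head e = v.1, ext δ e :=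
      fun _ => rfl
    simp only [hT, Finset.sum_sub_distrib]
    rw [hcol tail fun e => ⟨e, Or.inl rfl⟩, hcol head fun e => ⟨e, Or.inr rfl⟩, sub_self]
  rw [hδ] at hzero
  have : Nonempty V' := ⟨⟨tail e₁, ⟨e₁, he₁⟩, Or.inl rfl⟩⟩
  simp at hzero

theorem exists_pos_mul_abs_le {ι : Type*} [Finite ι] (s d : ι → ℝ) (hs : ∀ a, 0 ≤ s a)
    (h : ∀ a, s a = 0 → d a = 0) : ∃ ε > 0, ∀ a, ε * |d a| ≤ s a := by
  have key : ∀ᶠ ε in nhdsWithin (0 : ℝ) (Set.Ioi 0), ∀ a, ε * |d a| ≤ s a := by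
    rw [Filter.eventually_all]
    intro a
    rcases (hs a).eq_or_lt with h0 | h0
    · simp [h a h0.symm, ← h0]
    · have ht : Filter.Tendsto (fun ε : ℝ => ε * |d a|) (nhdsWithin 0 (Set.Ioi 0)) (nhds 0) := by
        refine Filter.Tendsto.mono_left ?_ nhdsWithin_le_nhds
        have : Continuous fun ε : ℝ => ε * |d a| := by fun_prop
        simpa using this.tendsto 0
      exact (ht.eventually (gt_mem_nhds h0)).mono fun ε hε => le_of_lt hε
  obtain ⟨ε, h1, h2⟩ := (key.and self_mem_nhdsWithin).exists
  exact ⟨ε, h2, h1⟩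

namespace LoopGraph

variable {q : ℕ}

/-- The throughput of a flow on the pairs of nodes of `S`, measured on the outgoing arcs. -/
noncomputable def rowSum (q : ℕ) : (Fin q × Fin q → ℝ) →L[ℝ] (Fin q → ℝ) :=
  ContinuousLinearMap.pi fun i => ∑ j, ContinuousLinearMap.proj (i, j)

theorem rowSum_apply (φ : Fin q × Fin q → ℝ) (i : Fin q) : rowSum q φ i = ∑ j, φ (i, j) := by
  simp [rowSum]

/-- The solution set is the image of a polytope of circulations with integral node capacities, so
every extreme point of it is the throughput of an extreme circulation, which is integral. -/
theorem exists_int_of_mem_extremePoints {S : LoopGraph (Fin q)} {x : Fin q → ℕ} {y : Fin q → ℝ}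
    (hy : y ∈ Set.extremePoints ℝ (S.lpSolutions x)) (i : Fin q) : ∃ n : ℤ, y i = n := by
  let P : Set (Fin q × Fin q → ℝ) := {φ | (∀ a, 0 ≤ φ a) ∧
    (∀ i j, s(i, j) ∉ S.edges → φ (i, j) = 0) ∧ (∀ j, ∑ i, φ (i, j) = ∑ i, φ (j, i)) ∧
    (∀ i, ∑ j, φ (i, j) ≤ (x i : ℝ)) ∧ ∑ i, y i ≤ ∑ i, ∑ j, φ (i, j)}
  have hfeas : ∀ φ : Fin q × Fin q → ℝ, (∀ a, 0 ≤ φ a) →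
      (∀ i j, s(i, j) ∉ S.edges → φ (i, j) = 0) → (∀ j, ∑ i, φ (i, j) = ∑ i, φ (j, i)) →
      (∀ i, ∑ j, φ (i, j) ≤ (x i : ℝ)) → rowSum q φ ∈ S.lpFeasible x := by
    intro φ h1 h2 h3 h4
    refine ⟨mem_edgeCone_iff.2 ⟨φ, h1, h2, fun i => (rowSum_apply φ i).symm, fun j => ?_⟩,
      fun i => ?_⟩
    · rw [rowSum_apply, h3]
    · rw [rowSum_apply]; exact h4 i
  have himage : rowSum q '' P = S.lpSolutions x := by
    ext z
    constructor
    · rintro ⟨φ, ⟨h1, h2, h3, h4, h5⟩, rfl⟩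
      refine ⟨hfeas φ h1 h2 h3 h4, fun y' hy' => (hy.1.2 y' hy').trans ?_⟩
      simpa only [rowSum_apply] using h5
    · intro hz
      obtain ⟨φ, hφ⟩ := mem_edgeCone_iff.1 hz.1.1
      refine ⟨φ, ⟨hφ.nonneg, hφ.supp, fun j => by rw [hφ.col, hφ.row], fun i => ?_, ?_⟩, ?_⟩
      · rw [hφ.row]; exact hz.1.2 i
      · simp only [hφ.row]; exact hz.2 y hy.1.1
      · ext i; rw [rowSum_apply, hφ.row]
  have hcompact : IsCompact P := by
    refine (isCompact_univ_pi (s := fun a : Fin q × Fin q => Set.Icc (0 : ℝ) (x a.1))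
      fun _ => isCompact_Icc).of_isClosed_subset ?_ ?_
    · simp only [P, Set.ofPred_and, Set.ofPred_forall]
      refine IsClosed.inter ?_ (IsClosed.inter ?_ (IsClosed.inter ?_ (IsClosed.inter ?_ ?_)))
      · exact isClosed_iInter fun a => isClosed_le (by fun_prop) (by fun_prop)
      · exact isClosed_iInter fun i => isClosed_iInter fun j => isClosed_iInter fun _ =>
          isClosed_eq (by fun_prop) (by fun_prop)
      · exact isClosed_iInter fun i => isClosed_eq (by fun_prop) (by fun_prop)
      · exact isClosed_iInter fun i => isClosed_le (by fun_prop) (by fun_prop)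
      · exact isClosed_le (by fun_prop) (by fun_prop)
    · rintro φ ⟨h1, -, -, h4, -⟩ a -
      refine ⟨h1 a, le_trans ?_ (h4 a.1)⟩
      exact Finset.single_le_sum (f := fun j => φ (a.1, j)) (fun j _ => h1 _) (Finset.mem_univ a.2)
  have hsurj := surjOn_extremePoints_image (rowSum q).toContinuousAffineMap hcompact
  have hy' : y ∈ Set.extremePoints ℝ ((rowSum q).toContinuousAffineMap '' P) := by
    have : ((rowSum q).toContinuousAffineMap : (Fin q × Fin q → ℝ) → Fin q → ℝ) '' P
        = S.lpSolutions x := himage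
    rwa [this]
  obtain ⟨φ, hφext, hφy⟩ := hsurj hy'
  have hφy : ∀ i, ∑ j, φ (i, j) = y i := fun i => by rw [← rowSum_apply]; exact congrFun hφy i
  obtain ⟨⟨h1, h2, h3, h4, h5⟩, hext⟩ := mem_extremePoints.1 hφext
  by_contra! hi
  -- the nodes are split: the node `i` becomes an arc from its entry `inr i` to its exit `inl i`
  obtain ⟨δ, hδ0, hδint, hδ⟩ := exists_ne_zero_conserved_of_not_int
    (E := (Fin q × Fin q) ⊕ Fin q) (V := Fin q ⊕ Fin q)
    (Sum.elim (fun a => Sum.inl a.1) Sum.inr) (Sum.elim (fun a => Sum.inr a.2) Sum.inl)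
    (by rintro (a | a) <;> simp) (Sum.elim φ y)
    (by
      rintro (v | v)
      · simp [Finset.sum_filter, Fintype.sum_prod_type]
        rw [Finset.sum_comm]
        simp [hφy]
      · simp [Finset.sum_filter, Fintype.sum_prod_type, h3, hφy])
    ⟨Sum.inr i, hi⟩
  have hrow : ∀ v, ∑ j, δ (Sum.inl (v, j)) = δ (Sum.inr v) := by
    intro v
    have := hδ (Sum.inl v)
    simp [Finset.sum_filter, Fintype.sum_prod_type] at this
    rw [Finset.sum_comm] at this
    simpa using this
  have hcol : ∀ v, ∑ j, δ (Sum.inl (j, v)) = δ (Sum.inr v) := by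
    intro v
    have := hδ (Sum.inr v)
    simpa [Finset.sum_filter, Fintype.sum_prod_type] using this.symm
  obtain ⟨ε, hε, hslack⟩ := exists_pos_mul_abs_le
    (Sum.elim φ (fun i => (x i : ℝ) - y i)) δ
    (by
      rintro (a | a)
      · exact h1 a
      · exact sub_nonneg.2 (by simpa only [hφy] using h4 a))
    (by
      rintro (a | a) h
      · exact hδint _ 0 (by simpa using h)
      · refine hδint _ (x a) ?_
        have : (x a : ℝ) - y a = 0 := h
        simp only [Sum.elim_inr, Int.cast_natCast]
        linarith)
  have hpert : ∀ r : ℝ, |r| = ε → (∀ a, 0 ≤ φ a + r * δ (Sum.inl a)) ∧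
      (∀ i j, s(i, j) ∉ S.edges → φ (i, j) + r * δ (Sum.inl (i, j)) = 0) ∧
      (∀ j, ∑ i, (φ (i, j) + r * δ (Sum.inl (i, j))) =
        ∑ i, (φ (j, i) + r * δ (Sum.inl (j, i)))) ∧
      (∀ i, ∑ j, (φ (i, j) + r * δ (Sum.inl (i, j))) ≤ (x i : ℝ)) := by
    intro r hr
    have habs : ∀ e, |r * δ e| ≤ Sum.elim φ (fun i => (x i : ℝ) - y i) e := fun e => by
      rw [abs_mul, hr]; exact hslack e
    refine ⟨fun a => ?_, fun i j hij => ?_, fun j => ?_, fun i => ?_⟩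
    · have := (abs_le.1 (habs (Sum.inl a))).1
      simp only [Sum.elim_inl] at this
      linarith
    · rw [h2 i j hij, hδint (Sum.inl (i, j)) 0 (by simpa using h2 i j hij)]
      simp
    · simp only [Finset.sum_add_distrib, ← Finset.mul_sum, h3, hrow, hcol]
    · simp only [Finset.sum_add_distrib, ← Finset.mul_sum, hrow, hφy]
      have := (abs_le.1 (habs (Sum.inr i))).2
      simp only [Sum.elim_inr] at this
      linarith
  have hle : ∀ r : ℝ, |r| = ε → r * ∑ i, δ (Sum.inr i) ≤ 0 := by
    intro r hr
    obtain ⟨g1, g2, g3, g4⟩ := hpert r hr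
    have := hy.1.2 _ (hfeas (fun a => φ a + r * δ (Sum.inl a)) g1 g2 g3 g4)
    simp only [rowSum_apply, Finset.sum_add_distrib, ← Finset.mul_sum, hrow, hφy] at this
    linarith
  have htot : ∑ i, δ (Sum.inr i) = 0 := by
    have e1 := hle ε (abs_of_pos hε)
    have e2 := hle (-ε) (by rw [abs_neg, abs_of_pos hε])
    have : ε * ∑ i, δ (Sum.inr i) = 0 := by linarith
    exact (mul_eq_zero.1 this).resolve_left hε.ne'
  have hmem : ∀ r : ℝ, |r| = ε → (fun a => φ a + r * δ (Sum.inl a)) ∈ P := by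
    intro r hr
    obtain ⟨g1, g2, g3, g4⟩ := hpert r hr
    refine ⟨g1, g2, g3, g4, ?_⟩
    simp only [Finset.sum_add_distrib, ← Finset.mul_sum, hrow, hφy, htot]
    simp
  have := (hext _ (hmem ε (abs_of_pos hε)) _ (hmem (-ε) (by rw [abs_neg, abs_of_pos hε])) ?_).1
  · apply hδ0
    have hz : ∀ a, δ (Sum.inl a) = 0 := by
      intro a
      have h := congrFun this a
      simp only [add_eq_left] at h
      exact (mul_eq_zero.1 h).resolve_left hε.ne'
    ext e
    rcases e with a | a
    · exact hz a
    · rw [← hrow a]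
      simp [hz]
  · refine ⟨1 / 2, 1 / 2, by norm_num, by norm_num, by norm_num, ?_⟩
    ext a
    simp only [Pi.add_apply, Pi.smul_apply, smul_eq_mul]
    ring

end LoopGraph

/-! ### Permutations of the nodes of `K_y` over `S` -/

namespace LoopGraph

variable {q : ℕ}

/-- Hall's theorem for the nodes of `K_y`: the condition on unions of fibres suffices, since
the neighbours of a node depend only on its projection to `S`. -/
theorem exists_perm_of_sum_le {S : LoopGraph (Fin q)} {y : Fin q → ℕ}
    (h : ∀ A B : Finset (Fin q), (∀ i ∈ A, ∀ j, s(i, j) ∈ S.edges → j ∈ B) →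
      ∑ i ∈ A, y i ≤ ∑ j ∈ B, y j) :
    ∃ σ : Equiv.Perm (Σ i : Fin q, Fin (y i)), ∀ v, s(v.1, (σ v).1) ∈ S.edges := by
  classical
  have hcard : ∀ A : Finset (Fin q),
      (Finset.univ.filter fun v : Σ i : Fin q, Fin (y i) => v.1 ∈ A).card = ∑ i ∈ A, y i := by
    intro A
    have : (Finset.univ.filter fun v : Σ i : Fin q, Fin (y i) => v.1 ∈ A)
        = A.sigma fun i => (Finset.univ : Finset (Fin (y i))) := by
      ext v; simp
    rw [this, Finset.card_sigma]
    simp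
  obtain ⟨f, hinj, hf⟩ := (Fintype.all_card_le_filter_rel_iff_exists_injective
    (fun v w : Σ i : Fin q, Fin (y i) => s(v.1, w.1) ∈ S.edges)).1 (by
      intro T
      calc T.card ≤ (Finset.univ.filter fun v : Σ i : Fin q, Fin (y i) =>
              v.1 ∈ T.image Sigma.fst).card := by
            refine Finset.card_le_card fun v hv => ?_
            simp only [Finset.mem_filter, Finset.mem_univ, true_and]
            exact Finset.mem_image_of_mem _ hv
        _ ≤ (Finset.univ.filter fun v : Σ i : Fin q, Fin (y i) =>
              v.1 ∈ Finset.univ.filter fun j => ∃ i ∈ T.image Sigma.fst, s(i, j) ∈ S.edges).card := by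
            rw [hcard, hcard]
            refine h _ _ fun i hi j hij => ?_
            simp only [Finset.mem_filter, Finset.mem_univ, true_and]
            exact ⟨i, hi, hij⟩
        _ ≤ _ := by
            refine Finset.card_le_card fun w hw => ?_
            simp only [Finset.mem_filter, Finset.mem_univ, true_and, Finset.mem_image] at hw ⊢
            obtain ⟨i, ⟨v, hv, rfl⟩, hij⟩ := hw
            exact ⟨v, hv, hij⟩)
  exact ⟨Equiv.ofBijective f hinj.bijective_of_finite, hf⟩

theorem sum_ite_eq_fst (y : Fin q → ℕ) (i : Fin q) :
    ∑ v : (Σ i : Fin q, Fin (y i)), (if i = v.1 then (1 : ℝ) else 0) = y i := by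
  rw [Fintype.sum_sigma, Finset.sum_eq_single i]
  · simp
  · intro j _ h
    simp [Ne.symm h]
  · simp

theorem mem_edgeCone_of_perm {S : LoopGraph (Fin q)} {y : Fin q → ℕ}
    (σ : Equiv.Perm (Σ i : Fin q, Fin (y i))) (hσ : ∀ v, s(v.1, (σ v).1) ∈ S.edges) :
    (fun i => (y i : ℝ)) ∈ S.edgeCone := by
  have : (fun i => (y i : ℝ)) = ∑ v, (1 : ℝ) • incVec s(v.1, (σ v).1) := by
    ext i
    simp only [Finset.sum_apply, Pi.smul_apply, smul_eq_mul, one_mul, incVec_mk,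
      ← Finset.sum_div, Finset.sum_add_distrib]
    rw [Equiv.sum_comp σ fun v => if i = v.1 then (1 : ℝ) else 0, sum_ite_eq_fst]
    ring
  rw [this]
  exact sum_mem_edgeCone _ _ fun v _ => smul_incVec_mem_edgeCone (hσ v) zero_le_one

end LoopGraph

/-- Composing a permutation with the transposition of two elements of distinct cycles merges
these cycles. -/
theorem Equiv.Perm.SameCycle.mul_swap {α : Type*} [DecidableEq α] [Finite α]
    {σ : Equiv.Perm α} {v w : α} (hvw : ¬ σ.SameCycle v w) :
    (σ * Equiv.swap v w).SameCycle v w ∧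
      ∀ a b, σ.SameCycle a b → (σ * Equiv.swap v w).SameCycle a b := by
  have hmain : ∀ v w : α, ¬ σ.SameCycle v w → (σ * Equiv.swap v w).SameCycle v w := by
    intro v w hvw
    set τ := σ * Equiv.swap v w with hτ
    -- from `v` on, `τ` follows the `σ`-cycle of `w`, which does not meet `v`
    have hstep : ∀ k : ℕ, (∃ l : ℕ, (τ ^ l) v = w) ∨ (τ ^ (k + 1)) v = (σ ^ (k + 1)) w := by
      intro k
      induction k with
      | zero => right; simp [hτ]
      | succ k ih =>
        rcases ih with ih | ih
        · exact Or.inl ih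
        · by_cases hk : (σ ^ (k + 1)) w = w
          · exact Or.inl ⟨k + 1, ih.trans hk⟩
          · right
            rw [pow_succ', Equiv.Perm.mul_apply, ih, hτ, Equiv.Perm.mul_apply,
              Equiv.swap_apply_of_ne_of_ne _ hk, ← Equiv.Perm.mul_apply, ← pow_succ']
            intro h
            exact hvw (Equiv.Perm.SameCycle.symm ⟨(k + 1 : ℕ), by rwa [zpow_natCast]⟩)
    obtain ⟨n, hn, hpow⟩ := isOfFinOrder_iff_pow_eq_one.1 (isOfFinOrder_of_finite σ)
    obtain ⟨l, hl⟩ | h := hstep (n - 1)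
    · exact ⟨l, by simpa using hl⟩
    · rw [Nat.sub_add_cancel hn, hpow] at h
      exact ⟨n, by simpa using h⟩
  have h1 := hmain v w hvw
  refine ⟨h1, ?_⟩
  have hone : ∀ a, (σ * Equiv.swap v w).SameCycle a (σ a) := by
    intro a
    by_cases hav : a = v
    · subst hav
      refine h1.trans ?_
      refine ⟨1, ?_⟩
      simp
    by_cases haw : a = w
    · subst haw
      refine h1.symm.trans ?_
      refine ⟨1, ?_⟩
      simp
    · refine ⟨1, ?_⟩
      simp [Equiv.swap_apply_of_ne_of_ne hav haw]
  have hpow : ∀ (n : ℕ) a, (σ * Equiv.swap v w).SameCycle a ((σ ^ n) a) := by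
    intro n
    induction n with
    | zero => intro a; exact Equiv.Perm.SameCycle.refl _ _
    | succ n ih =>
      intro a
      rw [pow_succ', Equiv.Perm.mul_apply]
      exact (ih a).trans (hone _)
  rintro a b hab
  obtain ⟨n, rfl⟩ := hab.exists_nat_pow_eq
  exact hpow n a

namespace LoopGraph

variable {q : ℕ}

/-- Among the permutations over `S`, one with the fewest cycles has each fibre of `K_y → S` inside
a single cycle. -/
theorem exists_perm_sameCycle {S : LoopGraph (Fin q)} {y : Fin q → ℕ}
    (h : (fun i => (y i : ℝ)) ∈ S.edgeCone) :
    ∃ σ : Equiv.Perm (Σ i : Fin q, Fin (y i)), (∀ v, s(v.1, (σ v).1) ∈ S.edges) ∧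
      ∀ v w, v.1 = w.1 → σ.SameCycle v w := by
  classical
  obtain ⟨σ₀, hσ₀⟩ := exists_perm_of_sum_le (S := S) (y := y) fun A B hAB => by
    exact_mod_cast sum_le_sum_of_mem_edgeCone h hAB
  have : Nonempty {σ : Equiv.Perm (Σ i : Fin q, Fin (y i)) // ∀ v, s(v.1, (σ v).1) ∈ S.edges} :=
    ⟨⟨σ₀, hσ₀⟩⟩
  obtain ⟨⟨σ, hσ⟩, hmax⟩ := Finite.exists_max
    fun σ : {σ : Equiv.Perm (Σ i : Fin q, Fin (y i)) // ∀ v, s(v.1, (σ v).1) ∈ S.edges} =>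
      (Finset.univ.filter fun a : (Σ i : Fin q, Fin (y i)) × (Σ i : Fin q, Fin (y i)) =>
        σ.1.SameCycle a.1 a.2).card
  refine ⟨σ, hσ, fun v w hvw => ?_⟩
  by_contra hne
  obtain ⟨h1, h2⟩ := Equiv.Perm.SameCycle.mul_swap hne
  refine absurd (hmax ⟨σ * Equiv.swap v w, fun a => ?_⟩) (not_le.2 (Finset.card_lt_card ?_))
  · have hfst : (Equiv.swap v w a).1 = a.1 := by
      by_cases hav : a = v
      · subst hav; simp [hvw]
      by_cases haw : a = w
      · subst haw; simp [hvw]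
      · rw [Equiv.swap_apply_of_ne_of_ne hav haw]
    rw [Equiv.Perm.mul_apply, ← hfst]
    exact hσ _
  · refine Finset.ssubset_iff_of_subset ?_ |>.2 ⟨(v, w), ?_, ?_⟩
    · intro a ha
      simp only [Finset.mem_filter, Finset.mem_univ, true_and] at ha ⊢
      exact h2 _ _ ha
    · simpa using h1
    · simpa using hne

end LoopGraph

/-! ### Cycles of a permutation as cycles of a graph -/

/-- The orbit of `v` under a permutation that moves along edges, and never moves back and forth, is
the node set of a cycle. -/
theorem SimpleGraph.exists_isCycleGraph_sameCycle {V : Type*} [Finite V] {G : SimpleGraph V}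
    {σ : Equiv.Perm V} (v : V) (hadj : ∀ w, G.Adj w (σ w)) (hne : σ (σ v) ≠ v) :
    ∃ C : G.Subgraph, C.IsCycleGraph ∧ C.verts = {w | σ.SameCycle v w} := by
  obtain ⟨n, hn⟩ : ∃ n, Function.minimalPeriod σ v = n + 3 := by
    have h0 : 0 < Function.minimalPeriod σ v := by
      obtain ⟨m, hm, hpow⟩ := isOfFinOrder_iff_pow_eq_one.1 (isOfFinOrder_of_finite σ)
      refine Function.minimalPeriod_pos_of_mem_periodicPts ⟨m, hm, ?_⟩
      rw [Function.IsPeriodicPt, Function.IsFixedPt, ← Equiv.Perm.coe_pow, hpow]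
      rfl
    have hp := Function.iterate_minimalPeriod (f := σ) (x := v)
    refine ⟨Function.minimalPeriod σ v - 3, ?_⟩
    by_contra hcon
    have : Function.minimalPeriod σ v = 1 ∨ Function.minimalPeriod σ v = 2 := by omega
    rcases this with h | h
    · rw [h] at hp
      exact (hadj v).ne hp.symm
    · rw [h] at hp
      exact hne hp
  have hmod : ∀ k : ℕ, σ^[k % (n + 3)] v = σ^[k] v := fun k => by
    rw [← hn]; exact Function.iterate_mod_minimalPeriod_eq
  have hsucc : ∀ a : Fin (n + 3), σ^[(a + 1 : Fin (n + 3)).val] v = σ (σ^[a.val] v) := by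
    intro a
    rw [Fin.val_add, hmod, ← Function.iterate_succ_apply' σ]
    simp
  let f : SimpleGraph.cycleGraph (n + 3) →g G :=
    { toFun := fun a => σ^[a.val] v
      map_rel' := by
        intro a b hab
        rw [SimpleGraph.cycleGraph_adj] at hab
        rcases hab with h | h
        · have : a = b + 1 := sub_eq_iff_eq_add'.1 h
          rw [this, hsucc]
          exact (hadj _).symm
        · have : b = a + 1 := sub_eq_iff_eq_add'.1 h
          rw [this, hsucc]
          exact hadj _ }
  have hf : ∀ a, f a = σ^[a.val] v := fun _ => rfl
  have hinj : Function.Injective f := by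
    intro a b hab
    refine Fin.ext (Function.iterate_injOn_Iio_minimalPeriod (f := σ) (x := v) ?_ ?_ hab)
    · rw [hn]; exact a.2
    · rw [hn]; exact b.2
  refine ⟨_, ⟨_, (SimpleGraph.cycleGraph.cycle n).map f,
    (SimpleGraph.Walk.isCycle_map_iff_of_injective hinj).2
      SimpleGraph.cycleGraph.isCycle_cycle, rfl⟩, ?_⟩
  ext w
  rw [SimpleGraph.Walk.mem_verts_toSubgraph, SimpleGraph.Walk.support_map, List.mem_map]
  constructor
  · rintro ⟨a, -, rfl⟩
    refine ⟨(a.val : ℕ), ?_⟩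
    rw [hf, zpow_natCast, Equiv.Perm.coe_pow]
  · intro hw
    obtain ⟨k, rfl⟩ := Equiv.Perm.SameCycle.exists_nat_pow_eq hw
    refine ⟨⟨k % (n + 3), Nat.mod_lt _ (by omega)⟩, ?_, ?_⟩
    · have hlt : k % (n + 3) < n + 3 := Nat.mod_lt _ (by omega)
      have := SimpleGraph.cycleGraph.getVert_cycle (n := n) (m := n + 3 - k % (n + 3)) (by omega)
      have h2 : (n + 3 - (n + 3 - k % (n + 3))) % (n + 3) = k % (n + 3) := by
        rw [Nat.sub_sub_self hlt.le, Nat.mod_mod]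
      simp only [h2] at this
      rw [← this]
      exact SimpleGraph.Walk.getVert_mem_support _ _
    · rw [hf]
      simp only [hmod, Equiv.Perm.coe_pow]

namespace LoopGraph

variable {q : ℕ}

/-- For an optimal integer vector every edge has a saturated endpoint, since otherwise the
incidence vector of the edge could be added. -/
theorem eq_or_eq_of_mem_lpSolutions {S : LoopGraph (Fin q)} {x y : Fin q → ℕ}
    (hy : (fun i => (y i : ℝ)) ∈ S.lpSolutions x) {i j : Fin q} (hij : s(i, j) ∈ S.edges) :
    y i = x i ∨ y j = x j := by
  by_contra! hcon
  have hi := lt_of_le_of_ne (le_of_mem_lpSolutions hy i) hcon.1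
  have hj := lt_of_le_of_ne (le_of_mem_lpSolutions hy j) hcon.2
  have hmem : (fun k => (y k : ℝ)) + (1 : ℝ) • incVec s(i, j) ∈ S.lpFeasible x := by
    refine ⟨add_mem_edgeCone hy.1.1 (smul_incVec_mem_edgeCone hij zero_le_one), fun k => ?_⟩
    simp only [Pi.add_apply, Pi.smul_apply, smul_eq_mul, one_mul, incVec_mk]
    have hk : (y k : ℝ) ≤ x k := by exact_mod_cast le_of_mem_lpSolutions hy k
    have h1 : k = i → (y k : ℝ) + 1 ≤ x k := by rintro rfl; exact_mod_cast hi
    have h2 : k = j → (y k : ℝ) + 1 ≤ x k := by rintro rfl; exact_mod_cast hj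
    split_ifs with h h' h'
    · linarith [h1 h]
    · linarith [h1 h]
    · linarith [h2 h']
    · linarith
  have := hy.2 _ hmem
  simp only [Pi.add_apply, Pi.smul_apply, smul_eq_mul, one_mul, incVec_mk,
    Finset.sum_add_distrib, ← Finset.sum_div] at this
  simp at this
  linarith

theorem exists_spanning_isDisjointUnionOfCycles {S : LoopGraph (Fin q)} {x y : Fin q → ℕ}
    (hx : ∀ i, 3 ≤ x i) (hy : (fun i => (y i : ℝ)) ∈ S.lpSolutions x) :
    ∃ H : (S.completePartite y).Subgraph, H.IsSpanning ∧
      ∃ k ≤ q, H.IsDisjointUnionOfCycles k := by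
  classical
  obtain ⟨σ, hσ, hcyc⟩ := exists_perm_sameCycle hy.1.1
  -- the two nodes of a short cycle of `σ` would have to exhaust a fibre with three nodes
  have hshort : ∀ v, σ (σ v) ≠ v := by
    intro v hv
    have horb : ∀ (n : ℕ), (σ ^ n) v = v ∨ (σ ^ n) v = σ v := by
      intro n
      induction n with
      | zero => left; rfl
      | succ n ih =>
        rw [pow_succ', Equiv.Perm.mul_apply]
        rcases ih with h | h
        · right; rw [h]
        · left; rw [h, hv]
    have hsmall : ∀ i, (∃ a, σ.SameCycle v a ∧ a.1 = i) → y i ≤ 2 := by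
      rintro i ⟨a, hva, rfl⟩
      have hsub : (Finset.univ : Finset (Fin (y a.1))).image (Sigma.mk a.1) ⊆ {v, σ v} := by
        intro b hb
        obtain ⟨c, -, rfl⟩ := Finset.mem_image.1 hb
        obtain ⟨n, hn⟩ := (hva.trans (hcyc a ⟨a.1, c⟩ rfl)).exists_nat_pow_eq
        rw [← hn]
        rcases horb n with h | h <;> simp [h]
      have := (Finset.card_le_card hsub).trans Finset.card_le_two
      rwa [Finset.card_image_of_injective _ sigma_mk_injective, Finset.card_univ,
        Fintype.card_fin] at this
    have h1 := hsmall _ ⟨v, Equiv.Perm.SameCycle.refl _ _, rfl⟩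
    have h2 := hsmall _ ⟨σ v, ⟨1, by simp⟩, rfl⟩
    rcases eq_or_eq_of_mem_lpSolutions hy (hσ v) with h | h
    · have := hx v.1; omega
    · have := hx (σ v).1; omega
  have hadj : ∀ v, (S.completePartite y).Adj v (σ v) := fun v =>
    ⟨fun h => hshort v (by rw [← h, ← h]), hσ v⟩
  let Q := Quotient (Equiv.Perm.SameCycle.setoid σ)
  have hQ : Fintype.card Q ≤ q := by
    have hinj : Function.Injective fun a : Q => a.out.1 := by
      intro a b hab
      rw [← Quotient.out_equiv_out]
      exact hcyc _ _ hab
    simpa using Fintype.card_le_of_injective _ hinj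
  choose C hC hverts using fun v =>
    SimpleGraph.exists_isCycleGraph_sameCycle (σ := σ) v hadj (hshort v)
  let e : Fin (Fintype.card Q) ≃ Q := (Fintype.equivFin Q).symm
  refine ⟨⨆ a, C (e a).out, ?_, Fintype.card Q, hQ, fun a => C (e a).out, fun a => hC _, ?_, rfl⟩
  · intro v
    rw [SimpleGraph.Subgraph.verts_iSup, Set.mem_iUnion]
    refine ⟨e.symm (Quotient.mk _ v), ?_⟩
    rw [hverts, Equiv.apply_symm_apply]
    exact Quotient.mk_out (s := Equiv.Perm.SameCycle.setoid σ) v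
  · intro a b hab
    rw [hverts, hverts, Set.disjoint_left]
    intro w hw hw'
    apply hab
    apply e.injective
    rw [← Quotient.out_equiv_out]
    exact Equiv.Perm.SameCycle.trans hw (Equiv.Perm.SameCycle.symm hw')

/-! ### The nodes of 2-regular subgraphs -/

/-- The sum of the projections of the nodes of a walk, its two ends counted by halves, is the sum of
the incidence vectors of its edges. -/
theorem walk_sum_mem_edgeCone {S : LoopGraph (Fin q)} {x : Fin q → ℕ}
    {u w : Σ i : Fin q, Fin (x i)} (p : (S.completePartite x).Walk u w) :
    (p.support.tail.map fun v => (Pi.single v.1 1 : Fin q → ℝ)).sum +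
      (1 / 2 : ℝ) • (Pi.single u.1 1 - Pi.single w.1 1) ∈ S.edgeCone := by
  induction p with
  | nil => simpa using zero_mem_edgeCone S
  | @cons u v w h p ih =>
    have := add_mem_edgeCone ih (smul_incVec_mem_edgeCone h.2 zero_le_one)
    convert this using 1
    rw [SimpleGraph.Walk.support_cons, List.tail_cons, ← SimpleGraph.Walk.cons_tail_support p]
    simp only [List.map_cons, List.sum_cons, List.tail_cons, incVec, Sym2.lift_mk]
    module

theorem sum_verts_mem_edgeCone {S : LoopGraph (Fin q)} {x : Fin q → ℕ}
    {H : (S.completePartite x).Subgraph} (hH : H.IsTwoRegular) [Fintype H.verts] :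
    ∑ v ∈ H.verts.toFinset, (Pi.single v.1 1 : Fin q → ℝ) ∈ S.edgeCone := by
  classical
  obtain ⟨k, C, hC, hdisj, rfl⟩ := hH
  have hU : (⨆ a, C a).verts.toFinset = Finset.univ.biUnion fun a => (C a).verts.toFinset := by
    ext v
    simp [SimpleGraph.Subgraph.verts_iSup]
  rw [hU, Finset.sum_biUnion]
  · refine sum_mem_edgeCone _ _ fun a _ => ?_
    obtain ⟨u, p, hp, hpa⟩ := hC a
    have hset : (C a).verts.toFinset = p.support.tail.toFinset := by
      ext v
      rw [Set.mem_toFinset, ← hpa, SimpleGraph.Walk.mem_verts_toSubgraph, List.mem_toFinset,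
        SimpleGraph.Walk.mem_support_iff]
      constructor
      · rintro (rfl | h)
        · exact SimpleGraph.Walk.end_mem_tail_support hp.not_nil
        · exact h
      · exact Or.inr
    rw [hset, List.sum_toFinset _ hp.support_nodup]
    simpa using walk_sum_mem_edgeCone p
  · intro a _ b _ hab
    rw [Function.onFun, Set.disjoint_toFinset]
    exact hdisj a b hab

theorem ncard_verts_le_of_isTwoRegular {S : LoopGraph (Fin q)} {x : Fin q → ℕ} {y : Fin q → ℝ}
    (hy : y ∈ S.lpSolutions x) {H : (S.completePartite x).Subgraph} (hH : H.IsTwoRegular) :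
    (H.verts.ncard : ℝ) ≤ ∑ i, y i := by
  classical
  have happ : ∀ i, (∑ v ∈ H.verts.toFinset, (Pi.single v.1 1 : Fin q → ℝ)) i =
      ∑ v ∈ H.verts.toFinset, if i = v.1 then (1 : ℝ) else 0 := by
    intro i
    rw [Finset.sum_apply]
    simp only [Pi.single_apply]
  have := hy.2 _ (show _ ∈ S.lpFeasible x from ⟨sum_verts_mem_edgeCone hH, fun i => ?_⟩)
  · refine le_trans (le_of_eq ?_) this
    simp only [happ]
    rw [Finset.sum_comm]
    simp [Set.ncard_eq_toFinset_card']
  · rw [happ]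
    calc _ ≤ ∑ v : (Σ i : Fin q, Fin (x i)), if i = v.1 then (1 : ℝ) else 0 :=
          Finset.sum_le_sum_of_subset_of_nonneg (Finset.subset_univ _) fun v _ _ => by
            split_ifs <;> norm_num
      _ = x i := sum_ite_eq_fst x i

theorem inclusion_injective (S : LoopGraph (Fin q)) {y x : Fin q → ℕ} (h : ∀ i, y i ≤ x i) :
    Function.Injective (S.inclusion h) := by
  rintro ⟨i, a⟩ ⟨j, b⟩ hab
  obtain ⟨rfl, h2⟩ := Sigma.mk.inj_iff.mp hab
  have h3 : a = b := Fin.castLE_injective (h i) (eq_of_heq h2)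
  rw [h3]

end LoopGraph

theorem SimpleGraph.Subgraph.IsTwoRegular.map {V W : Type*} {G : SimpleGraph V}
    {G' : SimpleGraph W} {H : G.Subgraph} (hH : H.IsTwoRegular) {f : G →g G'}
    (hf : Function.Injective f) : (H.map f).IsTwoRegular := by
  obtain ⟨k, C, hC, hdisj, rfl⟩ := hH
  refine ⟨k, fun a => (C a).map f, fun a => ?_, fun a b hab => ?_, ?_⟩
  · obtain ⟨v, p, hp, hpC⟩ := hC a
    exact ⟨f v, p.map f, (SimpleGraph.Walk.isCycle_map_iff_of_injective hf).2 hp, by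
      rw [SimpleGraph.Walk.toSubgraph_map, hpC]⟩
  · exact (Set.disjoint_image_iff hf).2 (hdisj a b hab)
  · ext v w
    · simp [SimpleGraph.Subgraph.verts_iSup, Set.image_iUnion]
    · simp only [SimpleGraph.Subgraph.map_adj, SimpleGraph.Subgraph.iSup_adj, Relation.Map]
      constructor
      · rintro ⟨a, b, ⟨i, h⟩, h1, h2⟩
        exact ⟨i, a, b, h, h1, h2⟩
      · rintro ⟨i, a, b, h, h1, h2⟩
        exact ⟨a, b, ⟨i, h⟩, h1, h2⟩

theorem LoopGraph.isLargestTwoRegular_map {q : ℕ} {S : LoopGraph (Fin q)} {x y : Fin q → ℕ}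
    (hy : (fun i => (y i : ℝ)) ∈ S.lpSolutions x) {H : (S.completePartite y).Subgraph}
    (hspan : H.IsSpanning) (hH : H.IsTwoRegular) :
    (H.map (S.inclusion (LoopGraph.le_of_mem_lpSolutions hy))).IsLargestTwoRegular := by
  have hinj := inclusion_injective S (LoopGraph.le_of_mem_lpSolutions hy)
  refine ⟨hH.map hinj, fun H' hH' => ?_⟩
  have h1 := ncard_verts_le_of_isTwoRegular hy hH'
  rw [SimpleGraph.Subgraph.map_verts, Set.ncard_image_of_injective _ hinj,
    SimpleGraph.Subgraph.isSpanning_iff.1 hspan, Set.ncard_univ, Nat.card_eq_fintype_card,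
    Fintype.card_sigma]
  simp only [Fintype.card_fin]
  exact_mod_cast h1

/-! ### Maximum flows in the bipartite double cover -/

namespace LoopGraph

variable {q : ℕ}

/-- A flow in the bipartite double cover of `S` (from a left copy to a right copy of the node set,
node capacities `x` on both sides) whose value attains the capacity of the vertex cover
`Aᶜ ∪ B`. Its vector of row sums is already an integer solution of the linear program, although
the column sums may differ from the row sums. Indeed, replacing the rows outside of `I` by rows of
the transposed flow gives another flow, and comparing the values yields `y(I) ≤ y(N(I))`. -/
theorem mem_lpSolutions_of_flow {S : LoopGraph (Fin q)} {x y c : Fin q → ℕ}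
    {φ : Fin q → Fin q → ℕ} (hsupp : ∀ i j, s(i, j) ∉ S.edges → φ i j = 0)
    (hrow : ∀ i, ∑ j, φ i j = y i) (hcol : ∀ j, ∑ i, φ i j = c j)
    (hy : ∀ i, y i ≤ x i) (hc : ∀ j, c j ≤ x j) {A B : Finset (Fin q)}
    (hAB : ∀ i ∈ A, ∀ j, s(i, j) ∈ S.edges → j ∈ B)
    (hval : ∑ i ∈ Aᶜ, x i + ∑ j ∈ B, x j ≤ ∑ i, y i) :
    (fun i => (y i : ℝ)) ∈ S.lpSolutions x := by
  classical
  have hmax : ∀ ψ : Fin q → Fin q → ℕ, (∀ i j, s(i, j) ∉ S.edges → ψ i j = 0) →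
      (∀ i, ∑ j, ψ i j ≤ x i) → (∀ j, ∑ i, ψ i j ≤ x j) → ∑ i, ∑ j, ψ i j ≤ ∑ i, y i := by
    intro ψ h1 h2 h3
    refine le_trans ?_ hval
    rw [← Finset.sum_add_sum_compl A, add_comm]
    refine add_le_add (Finset.sum_le_sum fun i _ => h2 i) ?_
    calc ∑ i ∈ A, ∑ j, ψ i j = ∑ i ∈ A, ∑ j ∈ B, ψ i j := by
          refine Finset.sum_congr rfl fun i hi => (Finset.sum_subset (Finset.subset_univ _) ?_).symm
          exact fun j _ hj => h1 i j fun hij => hj (hAB i hi j hij)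
      _ = ∑ j ∈ B, ∑ i ∈ A, ψ i j := Finset.sum_comm
      _ ≤ ∑ j ∈ B, x j := Finset.sum_le_sum fun j _ =>
          (Finset.sum_le_sum_of_subset (Finset.subset_univ _)).trans (h3 j)
  have hhall : ∀ I J : Finset (Fin q), (∀ i ∈ I, ∀ j, s(i, j) ∈ S.edges → j ∈ J) →
      ∑ i ∈ I, y i ≤ ∑ j ∈ J, y j := by
    intro I J hIJ
    have hIJ' : ∀ i j, j ∉ J → i ∈ I → φ j i = 0 := fun i j hj hi =>
      hsupp j i fun h => hj (hIJ i hi j (Sym2.eq_swap ▸ h))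
    let ψ : Fin q → Fin q → ℕ := fun i j =>
      if i ∈ I then φ i j else if j ∈ J then 0 else φ j i
    have hψI : ∀ i ∈ I, ∑ j, ψ i j = y i := fun i hi => by simp only [ψ, if_pos hi, hrow]
    have hψ := hmax ψ (fun i j hij => ?_) (fun i => ?_) (fun j => ?_)
    · have h1 : ∑ i ∈ Iᶜ, ∑ j, ψ i j = ∑ j ∈ Jᶜ, y j := by
        rw [Finset.sum_comm, ← Finset.sum_add_sum_compl J, Finset.sum_eq_zero, zero_add]
        · refine Finset.sum_congr rfl fun j hj => ?_
          rw [Finset.mem_compl] at hj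
          rw [← hrow j, ← Finset.sum_add_sum_compl I (fun i => φ j i),
            Finset.sum_eq_zero fun i hi => hIJ' i j hj hi, zero_add]
          refine Finset.sum_congr rfl fun i hi => ?_
          rw [Finset.mem_compl] at hi
          simp only [ψ, if_neg hi, if_neg hj]
        · intro j hj
          refine Finset.sum_eq_zero fun i hi => ?_
          rw [Finset.mem_compl] at hi
          simp only [ψ, if_neg hi, if_pos hj]
      have h2 := Finset.sum_add_sum_compl I fun i => ∑ j, ψ i j
      have h3 : ∑ i ∈ I, ∑ j, ψ i j = ∑ i ∈ I, y i := Finset.sum_congr rfl hψI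
      have h4 := Finset.sum_add_sum_compl J y
      omega
    · simp only [ψ]
      split_ifs
      · exact hsupp i j hij
      · rfl
      · exact hsupp j i fun h => hij (Sym2.eq_swap ▸ h)
    · by_cases hi : i ∈ I
      · rw [hψI i hi]; exact hy i
      · refine le_trans (Finset.sum_le_sum fun j _ => ?_) ((hcol i).le.trans (hc i))
        simp only [ψ, if_neg hi]
        split_ifs <;> simp
    · by_cases hj : j ∈ J
      · refine le_trans (Finset.sum_le_sum fun i _ => ?_) ((hcol j).le.trans (hc j))
        simp only [ψ, if_pos hj]
        split_ifs <;> simp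
      · refine le_trans (Finset.sum_le_sum fun i _ => ?_) ((hrow j).le.trans (hy j))
        simp only [ψ, if_neg hj]
        split_ifs with hi
        · rw [hsupp i j fun h => hj (hIJ i hi j h)]; exact Nat.zero_le _
        · exact le_rfl
  obtain ⟨σ, hσ⟩ := exists_perm_of_sum_le hhall
  refine ⟨⟨mem_edgeCone_of_perm σ hσ, fun i => Nat.cast_le.2 (hy i)⟩, fun z hz => ?_⟩
  calc ∑ i, z i = ∑ i ∈ A, z i + ∑ i ∈ Aᶜ, z i := (Finset.sum_add_sum_compl A z).symm
    _ ≤ ∑ j ∈ B, (x j : ℝ) + ∑ i ∈ Aᶜ, (x i : ℝ) :=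
        add_le_add ((sum_le_sum_of_mem_edgeCone hz.1 hAB).trans
          (Finset.sum_le_sum fun j _ => hz.2 j)) (Finset.sum_le_sum fun i _ => hz.2 i)
    _ ≤ ∑ i, (y i : ℝ) := by
        rw [add_comm]
        exact_mod_cast hval

end LoopGraph

/-! ### A push-relabel algorithm for the double cover -/

/-- A state of the push-relabel algorithm. The excess `x i` of the left node `i` is present from
the start, `x i - y i` of it being left; the right node `j` absorbs `x j` units, so that its
excess is `c j - x j`. There are no explicit source and sink. -/
structure PushState (q : ℕ) where
  /-- the preflow from the left nodes to the right nodes -/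
  φ : Fin q → Fin q → ℕ
  /-- the row sums of the preflow -/
  y : Fin q → ℕ
  /-- the column sums of the preflow -/
  c : Fin q → ℕ
  /-- the heights of the left nodes -/
  hL : Fin q → ℕ
  /-- the heights of the right nodes -/
  hR : Fin q → ℕ
  /-- the current arcs of the left nodes -/
  cL : Fin q → ℕ
  /-- the current arcs of the right nodes -/
  cR : Fin q → ℕ
  /-- the position in the current pass; left nodes precede right nodes -/
  p : ℕ

namespace PushState

variable {q : ℕ}

/-- A left node is active if it has excess and is not yet too high to reach a right node with
free capacity. The threshold leaves `2 * q + 1` levels strictly between it and `0`, one more than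
there are nodes. -/
def ActiveL (x : Fin q → ℕ) (σ : PushState q) (i : Fin q) : Prop :=
  σ.y i < x i ∧ σ.hL i < 2 * q + 2

/-- A right node is active if it has excess. -/
def ActiveR (x : Fin q → ℕ) (σ : PushState q) (j : Fin q) : Prop :=
  x j < σ.c j

/-- There are no active nodes. -/
def Idle (x : Fin q → ℕ) (σ : PushState q) : Prop :=
  (∀ i, ¬ σ.ActiveL x i) ∧ ∀ j, ¬ σ.ActiveR x j

/-- One elementary step at the node in position `p`: a relabelling by one once all arcs have been
scanned, a push along the current arc, or an advance of the current arc or of the position. A push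
from a left node always moves the whole excess, since the arcs are uncapacitated. -/
inductive Step (S : LoopGraph (Fin q)) (x : Fin q → ℕ) (σ : PushState q) : PushState q → Prop
  | relabelL (i : Fin q) (hp : σ.p = i) (ha : σ.ActiveL x i) (hc : q ≤ σ.cL i) :
      Step S x σ { σ with
        hL := Function.update σ.hL i (σ.hL i + 1)
        cL := Function.update σ.cL i 0 }
  | pushL (i j : Fin q) (hp : σ.p = i) (ha : σ.ActiveL x i) (hc : σ.cL i = j)
      (hS : s(i, j) ∈ S.edges) (hh : σ.hL i = σ.hR j + 1) :
      Step S x σ { σ with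
        φ := Function.update σ.φ i (Function.update (σ.φ i) j (σ.φ i j + (x i - σ.y i)))
        y := Function.update σ.y i (x i)
        c := Function.update σ.c j (σ.c j + (x i - σ.y i))
        p := σ.p + 1 }
  | scanL (i j : Fin q) (hp : σ.p = i) (ha : σ.ActiveL x i) (hc : σ.cL i = j)
      (hn : s(i, j) ∈ S.edges → σ.hL i ≠ σ.hR j + 1) :
      Step S x σ { σ with cL := Function.update σ.cL i (σ.cL i + 1) }
  | skipL (i : Fin q) (hp : σ.p = i) (ha : ¬ σ.ActiveL x i) :
      Step S x σ { σ with p := σ.p + 1 }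
  | relabelR (j : Fin q) (hp : σ.p = q + j) (ha : σ.ActiveR x j) (hc : q ≤ σ.cR j) :
      Step S x σ { σ with
        hR := Function.update σ.hR j (σ.hR j + 1)
        cR := Function.update σ.cR j 0 }
  | pushRSat (j k : Fin q) (hp : σ.p = q + j) (ha : σ.ActiveR x j) (hc : σ.cR j = k)
      (hφ : 0 < σ.φ k j) (hh : σ.hR j = σ.hL k + 1) (hlt : σ.φ k j < σ.c j - x j) :
      Step S x σ { σ with
        φ := Function.update σ.φ k (Function.update (σ.φ k) j 0)
        y := Function.update σ.y k (σ.y k - σ.φ k j)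
        c := Function.update σ.c j (σ.c j - σ.φ k j)
        cR := Function.update σ.cR j (σ.cR j + 1) }
  | pushREnd (j k : Fin q) (hp : σ.p = q + j) (ha : σ.ActiveR x j) (hc : σ.cR j = k)
      (hh : σ.hR j = σ.hL k + 1) (hle : σ.c j - x j ≤ σ.φ k j) :
      Step S x σ { σ with
        φ := Function.update σ.φ k (Function.update (σ.φ k) j (σ.φ k j - (σ.c j - x j)))
        y := Function.update σ.y k (σ.y k - (σ.c j - x j))
        c := Function.update σ.c j (x j)
        p := σ.p + 1 }
  | scanR (j k : Fin q) (hp : σ.p = q + j) (ha : σ.ActiveR x j) (hc : σ.cR j = k)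
      (hn : 0 < σ.φ k j → σ.hR j ≠ σ.hL k + 1) :
      Step S x σ { σ with cR := Function.update σ.cR j (σ.cR j + 1) }
  | skipR (j : Fin q) (hp : σ.p = q + j) (ha : ¬ σ.ActiveR x j) :
      Step S x σ { σ with p := σ.p + 1 }
  | wrap (hp : σ.p = 2 * q) : Step S x σ { σ with p := 0 }

/-- The invariant of the algorithm: a preflow with a valid labelling, in which the arcs before the
current arc of a node are not admissible. -/
structure Inv (S : LoopGraph (Fin q)) (x : Fin q → ℕ) (σ : PushState q) : Prop where
  supp : ∀ i j, s(i, j) ∉ S.edges → σ.φ i j = 0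
  row : ∀ i, ∑ j, σ.φ i j = σ.y i
  col : ∀ j, ∑ i, σ.φ i j = σ.c j
  y_le : ∀ i, σ.y i ≤ x i
  validL : ∀ i j, s(i, j) ∈ S.edges → σ.hL i ≤ σ.hR j + 1
  validR : ∀ i j, 0 < σ.φ i j → σ.hR j ≤ σ.hL i + 1
  bottom : ∀ j, σ.c j < x j → σ.hR j = 0
  curL : ∀ i j : Fin q, j.val < σ.cL i → s(i, j) ∈ S.edges → σ.hL i ≠ σ.hR j + 1
  curR : ∀ j k : Fin q, k.val < σ.cR j → 0 < σ.φ k j → σ.hR j ≠ σ.hL k + 1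
  cL_le : ∀ i, σ.cL i ≤ q
  cR_le : ∀ j, σ.cR j ≤ q
  hL_le : ∀ i, σ.hL i ≤ 2 * q + 2
  hR_le : ∀ j, σ.hR j ≤ 2 * q + 3
  p_le : σ.p ≤ 2 * q

theorem sum_update_add {ι : Type*} [Fintype ι] [DecidableEq ι] (f : ι → ℕ) (i : ι) (v : ℕ) :
    ∑ a, Function.update f i v a + f i = ∑ a, f a + v := by
  rw [Finset.sum_update_of_mem (Finset.mem_univ i), ← Finset.add_sum_erase _ f (Finset.mem_univ i),
    Finset.sdiff_singleton_eq_erase]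
  omega

theorem sum_row_update (φ : Fin q → Fin q → ℕ) (i j : Fin q) (v : ℕ) (a : Fin q) :
    ∑ b, Function.update φ i (Function.update (φ i) j v) a b + (if a = i then φ i j else 0) =
      ∑ b, φ a b + (if a = i then v else 0) := by
  by_cases h : a = i
  · subst h
    simp only [Function.update_self, if_true]
    exact sum_update_add (φ a) j v
  · simp [h]

theorem sum_col_update (φ : Fin q → Fin q → ℕ) (i j : Fin q) (v : ℕ) (b : Fin q) :
    ∑ a, Function.update φ i (Function.update (φ i) j v) a b + (if b = j then φ i j else 0) =
      ∑ a, φ a b + (if b = j then v else 0) := by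
  have hcongr : ∀ a, Function.update φ i (Function.update (φ i) j v) a b =
      Function.update (fun a => φ a b) i (Function.update (φ i) j v b) a := by
    intro a
    by_cases h : a = i
    · subst h; simp
    · simp [h]
  simp only [hcongr]
  have := sum_update_add (fun a => φ a b) i (Function.update (φ i) j v b)
  by_cases h : b = j
  · subst h
    simpa using this
  · simp [h]

theorem update_update_apply (φ : Fin q → Fin q → ℕ) (i j : Fin q) (v : ℕ) (a b : Fin q) :
    Function.update φ i (Function.update (φ i) j v) a b = if a = i ∧ b = j then v else φ a b := by
  by_cases h : a = i
  · subst h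
    simp [Function.update_apply]
  · simp [h]

theorem Inv.le_y {S : LoopGraph (Fin q)} {x : Fin q → ℕ} {σ : PushState q} (h : σ.Inv S x)
    (i j : Fin q) : σ.φ i j ≤ σ.y i := by
  rw [← h.row i]
  exact Finset.single_le_sum (f := σ.φ i) (fun _ _ => Nat.zero_le _) (Finset.mem_univ j)

theorem Inv.le_c {S : LoopGraph (Fin q)} {x : Fin q → ℕ} {σ : PushState q} (h : σ.Inv S x)
    (i j : Fin q) : σ.φ i j ≤ σ.c j := by
  rw [← h.col j]
  exact Finset.single_le_sum (f := fun i => σ.φ i j) (fun _ _ => Nat.zero_le _) (Finset.mem_univ i)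

theorem Inv.c_le {S : LoopGraph (Fin q)} {x : Fin q → ℕ} {σ : PushState q} (h : σ.Inv S x)
    (j : Fin q) : σ.c j ≤ ∑ i, x i := by
  rw [← h.col j]
  exact Finset.sum_le_sum fun i _ => (h.le_y i j).trans (h.y_le i)

/-- Returning `d` units along an arc `j → k` of the residual network. -/
theorem Inv.pushBack {S : LoopGraph (Fin q)} {x : Fin q → ℕ} {σ : PushState q} (h : σ.Inv S x)
    (j k : Fin q) (d : ℕ) (hd : d ≤ σ.φ k j) (hdx : x j ≤ σ.c j - d) :
    Inv S x { σ with
      φ := Function.update σ.φ k (Function.update (σ.φ k) j (σ.φ k j - d))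
      y := Function.update σ.y k (σ.y k - d)
      c := Function.update σ.c j (σ.c j - d) } := by
  have hle : ∀ a b, Function.update σ.φ k (Function.update (σ.φ k) j (σ.φ k j - d)) a b
      ≤ σ.φ a b := by
    intro a b
    rw [update_update_apply]
    split_ifs with hab
    · rw [hab.1, hab.2]; exact Nat.sub_le _ _
    · exact le_rfl
  have hy := h.le_y k j
  have hc := h.le_c k j
  constructor <;> try dsimp only
  · exact fun a b hab => Nat.le_zero.1 ((hle a b).trans (h.supp a b hab).le)
  · intro a
    have h1 := sum_row_update σ.φ k j (σ.φ k j - d) a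
    rw [h.row] at h1
    by_cases ha : a = k
    · subst ha
      simp only [Function.update_self, if_true] at h1 ⊢
      omega
    · simpa only [if_neg ha, add_zero, Function.update_of_ne ha] using h1
  · intro b
    have h1 := sum_col_update σ.φ k j (σ.φ k j - d) b
    rw [h.col] at h1
    by_cases hb : b = j
    · subst hb
      simp only [Function.update_self, if_true] at h1 ⊢
      omega
    · simpa only [if_neg hb, add_zero, Function.update_of_ne hb] using h1
  · intro a
    by_cases ha : a = k
    · subst ha
      rw [Function.update_self]
      exact (Nat.sub_le _ _).trans (h.y_le a)
    · rw [Function.update_of_ne ha]; exact h.y_le a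
  · exact h.validL
  · exact fun a b hab => h.validR a b (hab.trans_le (hle a b))
  · intro b hb
    by_cases hbj : b = j
    · subst hbj
      rw [Function.update_self] at hb
      omega
    · rw [Function.update_of_ne hbj] at hb
      exact h.bottom b hb
  · exact h.curL
  · exact fun b a hab hφ => h.curR b a hab (hφ.trans_le (hle a b))
  · exact h.cL_le
  · exact h.cR_le
  · exact h.hL_le
  · exact h.hR_le
  · exact h.p_le

/-- Pushes and relabellings keep the labelling valid. A push can only create a residual arc that
climbs, and a node is relabelled when it has no admissible arc, the arcs before its current arc
having stayed inadmissible since they were scanned. -/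
theorem Inv.step {S : LoopGraph (Fin q)} {x : Fin q → ℕ} {σ σ' : PushState q} (h : σ.Inv S x)
    (hs : Step S x σ σ') : σ'.Inv S x := by
  cases hs with
  | relabelL i hp ha hc =>
    refine { h with
      validL := fun a b hab => ?_, validR := fun a b hab => ?_, curL := fun a b hb hab => ?_
      curR := fun b a hb hab => ?_, cL_le := fun a => ?_, hL_le := fun a => ?_ } <;>
    dsimp only at * <;> rcases eq_or_ne a i with rfl | hai <;>
    simp only [Function.update_self, Function.update_of_ne, ne_eq, not_false_eq_true, *] at *
    · have h1 := h.validL a b hab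
      have h2 := h.curL a b (b.2.trans_le hc) hab
      omega
    · exact h.validL a b hab
    · have := h.validR a b hab; omega
    · exact h.validR a b hab
    · omega
    · exact h.curL a b hb hab
    · have := h.validR a b hab; omega
    · exact h.curR b a hb hab
    · exact Nat.zero_le _
    · exact h.cL_le a
    · have := ha.2; omega
    · exact h.hL_le a
  | pushL i j hp ha hc hS hh =>
    have hy := h.y_le i
    refine { h with
      supp := fun a b hab => ?_, row := fun a => ?_, col := fun b => ?_, y_le := fun a => ?_
      validR := fun a b hab => ?_, bottom := fun b hb => ?_, curR := fun b a hb hab => ?_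
      p_le := ?_ } <;> dsimp only at *
    · rw [update_update_apply, if_neg]
      · exact h.supp a b hab
      · rintro ⟨rfl, rfl⟩; exact hab hS
    · have h1 := sum_row_update σ.φ i j (σ.φ i j + (x i - σ.y i)) a
      rw [h.row] at h1
      by_cases hai : a = i
      · subst hai
        simp only [Function.update_self, if_true] at h1 ⊢
        omega
      · simpa only [if_neg hai, add_zero, Function.update_of_ne hai] using h1
    · have h1 := sum_col_update σ.φ i j (σ.φ i j + (x i - σ.y i)) b
      rw [h.col] at h1
      by_cases hbj : b = j
      · subst hbj
        simp only [Function.update_self, if_true] at h1 ⊢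
        omega
      · simpa only [if_neg hbj, add_zero, Function.update_of_ne hbj] using h1
    · by_cases hai : a = i
      · subst hai; rw [Function.update_self]
      · rw [Function.update_of_ne hai]; exact h.y_le a
    · rw [update_update_apply] at hab
      split_ifs at hab with hij
      · rw [hij.1, hij.2]; omega
      · exact h.validR a b hab
    · by_cases hbj : b = j
      · subst hbj
        rw [Function.update_self] at hb
        exact h.bottom b (by omega)
      · rw [Function.update_of_ne hbj] at hb
        exact h.bottom b hb
    · rw [update_update_apply] at hab
      split_ifs at hab with hij
      · rw [hij.1, hij.2]; omega
      · exact h.curR b a hb hab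
    · have := i.2; omega
  | scanL i j hp ha hc hn =>
    refine { h with curL := fun a b hb hab => ?_, cL_le := fun a => ?_ } <;> dsimp only at *
    · by_cases hai : a = i
      · subst hai
        rw [Function.update_self] at hb
        rcases Nat.lt_succ_iff_lt_or_eq.1 hb with h1 | h1
        · exact h.curL a b h1 hab
        · obtain rfl : b = j := Fin.ext (h1.trans hc)
          exact hn hab
      · rw [Function.update_of_ne hai] at hb
        exact h.curL a b hb hab
    · by_cases hai : a = i
      · subst hai
        rw [Function.update_self, hc]
        exact j.2
      · rw [Function.update_of_ne hai]; exact h.cL_le a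
  | skipL i hp ha => exact { h with p_le := by have := i.2; dsimp only; omega }
  | relabelR j hp ha hc =>
    have hback : ∀ a, 0 < σ.φ a j → σ.hR j ≤ σ.hL a := fun a hab => by
      have h1 := h.validR a j hab
      have h2 := h.curR j a (a.2.trans_le hc) hab
      omega
    refine { h with
      validL := fun a b hab => ?_, validR := fun a b hab => ?_, bottom := fun b hb => ?_
      curL := fun a b hb hab => ?_, curR := fun b a hb hab => ?_, cR_le := fun b => ?_
      hR_le := fun b => ?_ } <;>
    dsimp only at * <;> rcases eq_or_ne b j with rfl | hbj <;>
    simp only [Function.update_self, Function.update_of_ne, ne_eq, not_false_eq_true, *] at *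
    · have := h.validL a b hab; omega
    · exact h.validL a b hab
    · have := hback a hab; omega
    · exact h.validR a b hab
    · exact absurd hb ha.not_gt
    · exact h.bottom b hb
    · have := h.validL a b hab; omega
    · exact h.curL a b hb hab
    · omega
    · exact h.curR b a hb hab
    · exact Nat.zero_le _
    · exact h.cR_le b
    · -- a node with excess has an incoming unit of flow, hence a residual arc to a left node
      obtain ⟨a, ha0⟩ : ∃ a, 0 < σ.φ a b := by
        by_contra! hcon
        have h0 := h.col b
        rw [Finset.sum_eq_zero fun a _ => Nat.le_zero.1 (hcon a)] at h0
        have : x b < σ.c b := ha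
        omega
      have h1 := hback a ha0
      have h2 := h.hL_le a
      omega
    · exact h.hR_le b
  | pushRSat j k hp ha hc hφ hh hlt =>
    have h' := h.pushBack j k (σ.φ k j) le_rfl (by omega)
    rw [Nat.sub_self] at h'
    refine { h' with curR := fun b a hb hab => ?_, cR_le := fun b => ?_ } <;> dsimp only at *
    · by_cases hbj : b = j
      · subst hbj
        rw [Function.update_self] at hb
        rcases Nat.lt_succ_iff_lt_or_eq.1 hb with h1 | h1
        · exact h'.curR b a h1 hab
        · obtain rfl : a = k := Fin.ext (h1.trans hc)
          rw [update_update_apply, if_pos ⟨rfl, rfl⟩] at hab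
          exact absurd hab (lt_irrefl _)
      · rw [Function.update_of_ne hbj] at hb
        exact h'.curR b a hb hab
    · by_cases hbj : b = j
      · subst hbj
        rw [Function.update_self, hc]
        exact k.2
      · rw [Function.update_of_ne hbj]; exact h.cR_le b
  | pushREnd j k hp ha hc hh hle =>
    have hxc : x j < σ.c j := ha
    have h' := h.pushBack j k (σ.c j - x j) hle (by omega)
    rw [Nat.sub_sub_self hxc.le] at h'
    exact { h' with p_le := by have := j.2; dsimp only; omega }
  | scanR j k hp ha hc hn =>
    refine { h with curR := fun b a hb hab => ?_, cR_le := fun b => ?_ } <;> dsimp only at *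
    · by_cases hbj : b = j
      · subst hbj
        rw [Function.update_self] at hb
        rcases Nat.lt_succ_iff_lt_or_eq.1 hb with h1 | h1
        · exact h.curR b a h1 hab
        · obtain rfl : a = k := Fin.ext (h1.trans hc)
          exact hn hab
      · rw [Function.update_of_ne hbj] at hb
        exact h.curR b a hb hab
    · by_cases hbj : b = j
      · subst hbj
        rw [Function.update_self, hc]
        exact k.2
      · rw [Function.update_of_ne hbj]; exact h.cR_le b
  | skipR j hp ha => exact { h with p_le := by have := j.2; dsimp only; omega }
  | wrap hp => exact { h with p_le := Nat.zero_le _ }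

/-- If no node is active, then the heights leave out a level that separates the high nodes from
the low ones, and this cut shows that the flow is a maximum flow. -/
theorem Inv.mem_lpSolutions {S : LoopGraph (Fin q)} {x : Fin q → ℕ} {σ : PushState q}
    (h : σ.Inv S x) (hidle : σ.Idle x) : (fun i => (σ.y i : ℝ)) ∈ S.lpSolutions x := by
  classical
  obtain ⟨g, hg, hgn⟩ := Finset.exists_mem_notMem_of_card_lt_card
    (s := Finset.univ.image σ.hL ∪ Finset.univ.image σ.hR) (t := Finset.Icc 1 (2 * q + 1)) (by
      refine (Finset.card_union_le _ _).trans_lt ?_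
      have h1 := Finset.card_image_le (s := (Finset.univ : Finset (Fin q))) (f := σ.hL)
      have h2 := Finset.card_image_le (s := (Finset.univ : Finset (Fin q))) (f := σ.hR)
      rw [Finset.card_univ, Fintype.card_fin] at h1 h2
      rw [Nat.card_Icc]
      omega)
  rw [Finset.mem_Icc] at hg
  simp only [Finset.mem_union, Finset.mem_image, Finset.mem_univ, true_and, not_or,
    not_exists] at hgn
  have hc : ∀ j, σ.c j ≤ x j := fun j => not_lt.1 (hidle.2 j)
  refine LoopGraph.mem_lpSolutions_of_flow h.supp h.row h.col h.y_le hc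
    (A := Finset.univ.filter fun i => g < σ.hL i) (B := Finset.univ.filter fun j => g < σ.hR j)
    ?_ ?_
  · intro i hi j hij
    simp only [Finset.mem_filter, Finset.mem_univ, true_and] at hi ⊢
    have h1 := h.validL i j hij
    have h2 := hgn.2 j
    omega
  · set A := Finset.univ.filter fun i => g < σ.hL i with hA
    set B := Finset.univ.filter fun j => g < σ.hR j with hB
    rw [← Finset.sum_add_sum_compl A σ.y, add_comm]
    refine add_le_add ?_ (Finset.sum_le_sum fun i hi => ?_)
    · calc ∑ j ∈ B, x j ≤ ∑ j ∈ B, ∑ i ∈ A, σ.φ i j := by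
            refine Finset.sum_le_sum fun j hj => ?_
            have hj : g < σ.hR j := by simpa [hB] using hj
            have h1 : x j ≤ σ.c j := by
              by_contra! hlt
              have := h.bottom j hlt
              omega
            refine h1.trans (le_of_eq ?_)
            rw [← h.col j]
            refine (Finset.sum_subset (Finset.subset_univ _) fun i _ hi => ?_).symm
            have hi : ¬ g < σ.hL i := by simpa [hA] using hi
            by_contra hne
            have h2 := h.validR i j (Nat.pos_of_ne_zero hne)
            have h3 := hgn.1 i
            omega
        _ = ∑ i ∈ A, ∑ j ∈ B, σ.φ i j := Finset.sum_comm
        _ ≤ ∑ i ∈ A, σ.y i := Finset.sum_le_sum fun i _ => by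
            rw [← h.row i]
            exact Finset.sum_le_sum_of_subset (Finset.subset_univ _)
    · have hi : ¬ g < σ.hL i := by simpa [hA] using hi
      by_contra! hlt
      exact hidle.1 i ⟨hlt, by omega⟩

/-! ### The number of steps -/

/-- `M` bounds the heights of the active nodes, where the nodes that the current pass has already
visited count one higher. -/
structure Top (x : Fin q → ℕ) (σ : PushState q) (M : ℕ) : Prop where
  left : ∀ i : Fin q, σ.ActiveL x i → σ.hL i + (if i.val < σ.p then 1 else 0) ≤ M
  right : ∀ j : Fin q, σ.ActiveR x j → σ.hR j + (if q + j.val < σ.p then 1 else 0) ≤ M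

/-- The sum of the heights. -/
def heightSum (σ : PushState q) : ℕ := ∑ i, σ.hL i + ∑ j, σ.hR j

/-- The sum of the current arcs. -/
def curSum (σ : PushState q) : ℕ := ∑ i, σ.cL i + ∑ j, σ.cR j

/-- The potential of the algorithm. A pass lowers `M` by one, apart from increases that are paid by
relabellings; within a pass, each step advances the position or a current arc, or relabels. -/
def potential (σ : PushState q) (M : ℕ) : ℤ :=
  ((M : ℤ) + 2 * q * (2 * q + 3) - σ.heightSum) * (2 * q + 1) + (2 * q - σ.p) +
    (2 * q * (2 * q + 3) - σ.heightSum) * (q + 1) + (2 * q * q - σ.curSum)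

theorem Inv.potential_nonneg {S : LoopGraph (Fin q)} {x : Fin q → ℕ} {σ : PushState q}
    (h : σ.Inv S x) (M : ℕ) : 0 ≤ σ.potential M := by
  have hh : σ.heightSum ≤ 2 * q * (2 * q + 3) := by
    have h1 := Finset.sum_le_card_nsmul Finset.univ σ.hL (2 * q + 3)
      fun i _ => (h.hL_le i).trans (Nat.le_succ _)
    have h2 := Finset.sum_le_card_nsmul Finset.univ σ.hR (2 * q + 3) fun i _ => h.hR_le i
    rw [Finset.card_univ, Fintype.card_fin, smul_eq_mul] at h1 h2
    unfold heightSum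
    linarith
  have hc : σ.curSum ≤ 2 * q * q := by
    have h1 := Finset.sum_le_card_nsmul Finset.univ σ.cL q fun i _ => h.cL_le i
    have h2 := Finset.sum_le_card_nsmul Finset.univ σ.cR q fun i _ => h.cR_le i
    rw [Finset.card_univ, Fintype.card_fin, smul_eq_mul] at h1 h2
    unfold curSum
    linarith
  have hp := h.p_le
  zify at hh hc hp
  unfold potential
  have h1 : 0 ≤ ((M : ℤ) + 2 * q * (2 * q + 3) - σ.heightSum) * (2 * q + 1) :=
    mul_nonneg (by linarith [Int.natCast_nonneg M]) (by positivity)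
  have h2 : 0 ≤ (2 * (q : ℤ) * (2 * q + 3) - σ.heightSum) * (q + 1) :=
    mul_nonneg (by linarith) (by positivity)
  linarith

/-- While there are active nodes, each step lowers the potential. -/
theorem Inv.step_potential {S : LoopGraph (Fin q)} {x : Fin q → ℕ} {σ σ' : PushState q}
    (h : σ.Inv S x) (hs : Step S x σ σ') {M : ℕ} (hM : σ.Top x M) :
    σ'.Idle x ∨ ∃ M', σ'.Top x M' ∧ σ'.potential M' + 1 ≤ σ.potential M := by
  cases hs with
  | relabelL i hp ha hc =>
    refine Or.inr ⟨M + 1, ⟨fun a haa => ?_, fun b hb => (hM.right b hb).trans (Nat.le_succ _)⟩, ?_⟩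
    · rcases eq_or_ne a i with rfl | hai
      · have := hM.left a ha
        simp only [Function.update_self] at *
        omega
      · simp only [ActiveL, Function.update_of_ne hai] at *
        exact (hM.left a haa).trans (Nat.le_succ _)
    · have h1 := sum_update_add σ.hL i (σ.hL i + 1)
      have h2 := sum_update_add σ.cL i 0
      have h3 : σ.cL i = q := le_antisymm (h.cL_le i) hc
      rw [h3] at h2
      zify at h1 h2
      simp only [potential, heightSum, curSum]
      push_cast
      nlinarith
  | pushL i j hp ha hc hS hh =>
    refine Or.inr ⟨M, ⟨fun a haa => ?_, fun b hb => ?_⟩, ?_⟩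
    · rcases eq_or_ne a i with rfl | hai
      · simp [ActiveL] at haa
      · simp only [ActiveL, Function.update_of_ne hai] at *
        have h1 := hM.left a haa
        have h2 : a.val ≠ i.val := fun h => hai (Fin.ext h)
        split_ifs at h1 ⊢ <;> omega
    · have hi := i.2
      rw [if_neg (by dsimp only; omega)]
      rcases eq_or_ne b j with rfl | hbj
      · have := hM.left i ha
        dsimp only
        omega
      · simp only [ActiveR, Function.update_of_ne hbj] at hb
        exact le_trans (Nat.le_add_right _ _) (hM.right b hb)
    · simp only [potential, heightSum, curSum]
      push_cast
      linarith
  | scanL i j hp ha hc hn =>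
    refine Or.inr ⟨M, ⟨hM.left, hM.right⟩, ?_⟩
    have h2 := sum_update_add σ.cL i (σ.cL i + 1)
    zify at h2
    simp only [potential, heightSum, curSum]
    push_cast
    linarith
  | skipL i hp ha =>
    refine Or.inr ⟨M, ⟨fun a haa => ?_, fun b hb => ?_⟩, ?_⟩
    · have h1 := hM.left a haa
      have h2 : a.val ≠ i.val := fun h => ha ((Fin.ext h : a = i) ▸ haa)
      dsimp only
      split_ifs at h1 ⊢ <;> omega
    · have hi := i.2
      rw [if_neg (by dsimp only; omega)]
      exact le_trans (Nat.le_add_right _ _) (hM.right b hb)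
    · simp only [potential, heightSum, curSum]
      push_cast
      linarith
  | relabelR j hp ha hc =>
    refine Or.inr ⟨M + 1, ⟨fun a haa => (hM.left a haa).trans (Nat.le_succ _), fun b hb => ?_⟩, ?_⟩
    · rcases eq_or_ne b j with rfl | hbj
      · have := hM.right b ha
        simp only [Function.update_self] at *
        omega
      · simp only [Function.update_of_ne hbj] at *
        exact (hM.right b hb).trans (Nat.le_succ _)
    · have h1 := sum_update_add σ.hR j (σ.hR j + 1)
      have h2 := sum_update_add σ.cR j 0
      have h3 : σ.cR j = q := le_antisymm (h.cR_le j) hc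
      rw [h3] at h2
      zify at h1 h2
      simp only [potential, heightSum, curSum]
      push_cast
      nlinarith
  | pushRSat j k hp ha hc hφ hh hlt =>
    refine Or.inr ⟨M, ⟨fun a haa => ?_, fun b hb => ?_⟩, ?_⟩
    · rcases eq_or_ne a k with rfl | hak
      · have := hM.right j ha
        dsimp only
        split_ifs <;> omega
      · simp only [ActiveL, Function.update_of_ne hak] at haa
        exact hM.left a haa
    · rcases eq_or_ne b j with rfl | hbj
      · exact hM.right b ha
      · simp only [ActiveR, Function.update_of_ne hbj] at hb
        exact hM.right b hb
    · have h2 := sum_update_add σ.cR j (σ.cR j + 1)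
      zify at h2
      simp only [potential, heightSum, curSum]
      push_cast
      linarith
  | pushREnd j k hp ha hc hh hle =>
    refine Or.inr ⟨M, ⟨fun a haa => ?_, fun b hb => ?_⟩, ?_⟩
    · rcases eq_or_ne a k with rfl | hak
      · have := hM.right j ha
        dsimp only
        split_ifs <;> omega
      · simp only [ActiveL, Function.update_of_ne hak] at haa
        have h1 := hM.left a haa
        have := a.2
        rw [if_pos (by omega)] at h1
        dsimp only
        split_ifs <;> omega
    · rcases eq_or_ne b j with rfl | hbj
      · simp [ActiveR] at hb
      · simp only [ActiveR, Function.update_of_ne hbj] at hb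
        have h1 := hM.right b hb
        have h2 : b.val ≠ j.val := fun h => hbj (Fin.ext h)
        dsimp only
        split_ifs at h1 ⊢ <;> omega
    · simp only [potential, heightSum, curSum]
      push_cast
      linarith
  | scanR j k hp ha hc hn =>
    refine Or.inr ⟨M, ⟨hM.left, hM.right⟩, ?_⟩
    have h2 := sum_update_add σ.cR j (σ.cR j + 1)
    zify at h2
    simp only [potential, heightSum, curSum]
    push_cast
    linarith
  | skipR j hp ha =>
    refine Or.inr ⟨M, ⟨fun a haa => ?_, fun b hb => ?_⟩, ?_⟩
    · have h1 := hM.left a haa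
      have := a.2
      rw [if_pos (by omega)] at h1
      dsimp only
      split_ifs <;> omega
    · have h1 := hM.right b hb
      have h2 : b.val ≠ j.val := fun h => ha ((Fin.ext h : b = j) ▸ hb)
      dsimp only
      split_ifs at h1 ⊢ <;> omega
    · simp only [potential, heightSum, curSum]
      push_cast
      linarith
  | wrap hp =>
    have hl : ∀ i, σ.ActiveL x i → σ.hL i + 1 ≤ M := fun i hi => by
      have h1 := hM.left i hi
      have := i.2
      rwa [if_pos (by omega)] at h1
    have hr : ∀ j, σ.ActiveR x j → σ.hR j + 1 ≤ M := fun j hj => by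
      have h1 := hM.right j hj
      have := j.2
      rwa [if_pos (by omega)] at h1
    rcases M.eq_zero_or_pos with rfl | hpos
    · exact Or.inl ⟨fun i hi => absurd (hl i hi) (by omega), fun j hj => absurd (hr j hj) (by omega)⟩
    · refine Or.inr ⟨M - 1, ⟨fun i hi => ?_, fun j hj => ?_⟩, ?_⟩
      · have := hl i hi
        simp only [not_lt_zero, if_false]
        omega
      · have := hr j hj
        simp only [not_lt_zero, if_false]
        omega
      · simp only [potential, heightSum, curSum, hp, Nat.cast_sub hpos]
        push_cast
        linarith

theorem Idle.step {S : LoopGraph (Fin q)} {x : Fin q → ℕ} {σ σ' : PushState q} (h : σ.Idle x)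
    (hs : Step S x σ σ') : σ'.Idle x := by
  cases hs with
  | relabelL i hp ha hc => exact absurd ha (h.1 i)
  | pushL i j hp ha hc hS hh => exact absurd ha (h.1 i)
  | scanL i j hp ha hc hn => exact absurd ha (h.1 i)
  | skipL i hp ha => exact h
  | relabelR j hp ha hc => exact absurd ha (h.2 j)
  | pushRSat j k hp ha hc hφ hh hlt => exact absurd ha (h.2 j)
  | pushREnd j k hp ha hc hh hle => exact absurd ha (h.2 j)
  | scanR j k hp ha hc hn => exact absurd ha (h.2 j)
  | skipR j hp ha => exact h
  | wrap hp => exact h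

end PushState

/-! ### Verification of loop-free programs -/

namespace Ram

/-- The largest constant in an expression. -/
def Term.maxConst : Term → ℕ
  | .const n => n
  | .read _ i => i.maxConst
  | .op _ e₁ e₂ => max e₁.maxConst e₂.maxConst

theorem Op.eval_le_pow {b m n k l : ℕ} (o : Op) (hb : 2 ≤ b) (hm : m ≤ b ^ k) (hn : n ≤ b ^ l) :
    o.eval m n ≤ b ^ (k + l + 1) := by
  have h1 : 1 ≤ b ^ k := Nat.one_le_pow _ _ (by omega)
  have h2 : 1 ≤ b ^ l := Nat.one_le_pow _ _ (by omega)
  have h3 : b ^ k * b ^ l * 2 ≤ b ^ (k + l + 1) := by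
    rw [pow_succ, pow_add]
    exact Nat.mul_le_mul_left _ hb
  have hk : b ^ k ≤ b ^ k * b ^ l := Nat.le_mul_of_pos_right _ h2
  have hl : b ^ l ≤ b ^ k * b ^ l := Nat.le_mul_of_pos_left _ h1
  cases o <;> simp only [Op.eval]
  · omega
  · omega
  · have := Nat.mul_le_mul hm hn
    omega
  · have := Nat.div_le_self m n
    omega
  · split_ifs <;> omega
  · split_ifs <;> omega

/-- If all cells hold numbers up to `b`, then polynomially larger words suffice for the evaluation
of an expression. -/
theorem Term.fits_of_pow_le {b B : ℕ} {s : Mem} (hb : 2 ≤ b) (hs : ∀ a n, s a n ≤ b) (e : Term) :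
    e.maxConst ≤ b → b ^ e.cost ≤ B → e.Fits B s ∧ e.eval s ≤ b ^ e.cost := by
  induction e with
  | const n =>
    intro h1 h2
    simp only [Term.maxConst, Term.cost, pow_one] at h1 h2
    exact ⟨h1.trans h2, by simpa [Term.eval, Term.cost] using h1⟩
  | read a i ih =>
    intro h1 h2
    have h3 : b ^ i.cost ≤ b ^ (i.cost + 1) := Nat.pow_le_pow_right (by omega) (Nat.le_succ _)
    have h4 : b ≤ b ^ (i.cost + 1) := by
      simpa using Nat.pow_le_pow_right (n := b) (by omega) (Nat.le_add_left 1 i.cost)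
    obtain ⟨f1, f2⟩ := ih h1 (h3.trans h2)
    exact ⟨⟨f1, (hs _ _).trans (h4.trans h2)⟩, (hs _ _).trans h4⟩
  | op o e₁ e₂ ih₁ ih₂ =>
    intro h1 h2
    simp only [Term.maxConst, max_le_iff] at h1
    simp only [Term.cost] at h2 ⊢
    obtain ⟨f1, g1⟩ := ih₁ h1.1 (le_trans (Nat.pow_le_pow_right (by omega) (by omega)) h2)
    obtain ⟨f2, g2⟩ := ih₂ h1.2 (le_trans (Nat.pow_le_pow_right (by omega) (by omega)) h2)
    have := Op.eval_le_pow o hb g1 g2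
    exact ⟨⟨f1, f2, this.trans h2⟩, this⟩

/-- All expressions of a program have cost and constants up to `K`. -/
def Cmd.Small (K : ℕ) : Cmd → Prop
  | .skip => True
  | .set _ i e => (i.cost ≤ K ∧ i.maxConst ≤ K) ∧ e.cost ≤ K ∧ e.maxConst ≤ K
  | .seq c₁ c₂ => c₁.Small K ∧ c₂.Small K
  | .cond e c₁ c₂ => (e.cost ≤ K ∧ e.maxConst ≤ K) ∧ c₁.Small K ∧ c₂.Small K
  | .loop e c => (e.cost ≤ K ∧ e.maxConst ≤ K) ∧ c.Small K

/-- An upper bound for the number of steps of a loop-free program. -/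
def Cmd.cost : Cmd → ℕ
  | .skip => 1
  | .set _ i e => i.cost + e.cost + 1
  | .seq c₁ c₂ => c₁.cost + c₂.cost
  | .cond e c₁ c₂ => e.cost + 1 + (c₁.cost + c₂.cost)
  | .loop _ _ => 0

/-- The weakest precondition for a loop-free program to write only numbers up to `b` and to halt in
a memory that satisfies `Q`. -/
def Cmd.wp (b : ℕ) : Cmd → Mem → (Mem → Prop) → Prop
  | .skip, s, Q => Q s
  | .set a i e, s, Q => e.eval s ≤ b ∧ Q (s.write a (i.eval s) (e.eval s))
  | .seq c₁ c₂, s, Q => c₁.wp b s fun s' => c₂.wp b s' Q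
  | .cond e c₁ c₂, s, Q => (e.eval s ≠ 0 → c₁.wp b s Q) ∧ (e.eval s = 0 → c₂.wp b s Q)
  | .loop _ _, _, _ => False

theorem Mem.write_self (s : Mem) (a i v : ℕ) : s.write a i v a = Function.update (s a) i v :=
  Function.update_self ..

theorem Mem.write_of_ne (s : Mem) {a c : ℕ} (h : c ≠ a) (i v : ℕ) : s.write a i v c = s c :=
  Function.update_of_ne h ..

theorem Mem.write_le {s : Mem} {b a i v : ℕ} (hs : ∀ a n, s a n ≤ b) (hv : v ≤ b) (c n : ℕ) :
    s.write a i v c n ≤ b := by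
  by_cases hc : c = a
  · subst hc
    rw [Mem.write_self, Function.update_apply]
    split_ifs
    · exact hv
    · exact hs _ _
  · rw [Mem.write_of_ne _ hc]
    exact hs _ _

theorem Cmd.exists_runs_of_wp {b B K : ℕ} (hb : 2 ≤ b) (hK : K ≤ b) (hB : b ^ K ≤ B) (c : Cmd) :
    ∀ (s : Mem) (Q : Mem → Prop), c.Small K → (∀ a n, s a n ≤ b) → c.wp b s Q →
      ∃ t s', Runs B c s t s' ∧ t ≤ c.cost ∧ (∀ a n, s' a n ≤ b) ∧ Q s' := by
  have hfits : ∀ {s : Mem}, (∀ a n, s a n ≤ b) → ∀ e : Term, e.cost ≤ K ∧ e.maxConst ≤ K →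
      e.Fits B s := fun hs e he => (Term.fits_of_pow_le hb hs e (he.2.trans hK)
        ((Nat.pow_le_pow_right (by omega) he.1).trans hB)).1
  induction c with
  | skip => exact fun s Q _ hs hQ => ⟨_, _, Runs.skip s, le_rfl, hs, hQ⟩
  | set a i e =>
    exact fun s Q hsm hs hQ => ⟨_, _, Runs.set a i e s (hfits hs i hsm.1) (hfits hs e hsm.2), le_rfl,
      Mem.write_le hs hQ.1, hQ.2⟩
  | seq c₁ c₂ ih₁ ih₂ =>
    intro s Q hsm hs hQ
    obtain ⟨t₁, s₁, h₁, ht₁, hs₁, hQ₁⟩ := ih₁ s _ hsm.1 hs hQ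
    obtain ⟨t₂, s₂, h₂, ht₂, hs₂, hQ₂⟩ := ih₂ s₁ _ hsm.2 hs₁ hQ₁
    exact ⟨_, _, Runs.seq c₁ c₂ s s₁ s₂ t₁ t₂ h₁ h₂, add_le_add ht₁ ht₂, hs₂, hQ₂⟩
  | cond e c₁ c₂ ih₁ ih₂ =>
    intro s Q hsm hs hQ
    have he := hfits hs e hsm.1
    by_cases hv : e.eval s = 0
    · obtain ⟨t, s', h, ht, hs', hQ'⟩ := ih₂ s Q hsm.2.2 hs (hQ.2 hv)
      refine ⟨_, _, Runs.cond_false e c₁ c₂ s s' t he hv h, ?_, hs', hQ'⟩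
      simp only [Cmd.cost]; omega
    · obtain ⟨t, s', h, ht, hs', hQ'⟩ := ih₁ s Q hsm.2.1 hs (hQ.1 hv)
      refine ⟨_, _, Runs.cond_true e c₁ c₂ s s' t he hv h, ?_, hs', hQ'⟩
      simp only [Cmd.cost]; omega
  | loop e c _ => exact fun s Q _ _ hQ => hQ.elim

/-- A loop with an invariant `I k` that is indexed by the number `k` of completed iterations, and
a guard that fails exactly after `N` of them. -/
theorem Cmd.exists_runs_loop {b B K : ℕ} (hb : 2 ≤ b) (hK : K ≤ b) (hB : b ^ K ≤ B) {e : Term}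
    {c : Cmd} (hsm : (Cmd.loop e c).Small K) (I : ℕ → Mem → Prop) {N : ℕ}
    (hstep : ∀ k s, k < N → (∀ a n, s a n ≤ b) → I k s → e.eval s ≠ 0 ∧ c.wp b s (I (k + 1)))
    (hend : ∀ s, I N s → e.eval s = 0) {s : Mem} (hs : ∀ a n, s a n ≤ b) (h0 : I 0 s) :
    ∃ t s', Runs B (.loop e c) s t s' ∧ t ≤ (N + 1) * (e.cost + 1 + c.cost) ∧ I N s' := by
  have hfits : ∀ {s : Mem}, (∀ a n, s a n ≤ b) → e.Fits B s := fun hs =>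
    (Term.fits_of_pow_le hb hs e (hsm.1.2.trans hK)
      ((Nat.pow_le_pow_right (by omega) hsm.1.1).trans hB)).1
  have key : ∀ n k s, k + n = N → (∀ a n, s a n ≤ b) → I k s →
      ∃ t s', Runs B (.loop e c) s t s' ∧ t ≤ (n + 1) * (e.cost + 1 + c.cost) ∧ I N s' := by
    intro n
    induction n with
    | zero =>
      rintro k s rfl hs hI
      refine ⟨_, s, Runs.loop_done e c s (hfits hs) (hend s hI), ?_, hI⟩
      rw [zero_add, one_mul]
      exact Nat.le_add_right _ _
    | succ n ih =>
      intro k s hk hs hI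
      obtain ⟨hv, hwp⟩ := hstep k s (by omega) hs hI
      obtain ⟨t₁, s₁, h₁, ht₁, hs₁, hI₁⟩ := c.exists_runs_of_wp hb hK hB s _ hsm.2 hs hwp
      obtain ⟨t₂, s₂, h₂, ht₂, hI₂⟩ := ih (k + 1) s₁ (by omega) hs₁ hI₁
      refine ⟨_, s₂, Runs.loop_step e c s s₁ s₂ t₁ t₂ (hfits hs) hv h₁ h₂, ?_, hI₂⟩
      rw [Nat.succ_mul (n + 1)]
      omega
  exact key N 0 s (by omega) hs h0

end Ram

/-! ### The program -/

namespace Ram.PushRelabel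

/-- The scalar that is stored in cell `0` of an array: `q` in array `0`, the position in the current
pass in array `10`, the number of iterations in array `11`. -/
def scalar (a : ℕ) : Term := .read a (.const 0)

/-- The index of a matrix entry in the row-by-row order. -/
def index (i j : Term) : Term := .op .add (.op .mul i (scalar 0)) j

/-- The right node in position `p`. -/
def rightNode : Term := .op .sub (scalar 10) (scalar 0)

/-- The successor of the value of an expression. -/
def addOne (e : Term) : Term := .op .add e (.const 1)

/-- Go to the next position. -/
def next : Cmd := .set 10 (.const 0) (addOne (scalar 10))

/-- The excess of the left node in position `p`. -/
def excessL : Term := .op .sub (.read 2 (scalar 10)) (.read 3 (scalar 10))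

/-- The current arc of the left node in position `p`. -/
def arcL : Term := .read 8 (scalar 10)

/-- Move the whole excess of the left node in position `p` along its current arc. -/
def pushL : Cmd :=
  .seq (.set 4 (index (scalar 10) arcL) (.op .add (.read 4 (index (scalar 10) arcL)) excessL))
    (.seq (.set 5 arcL (.op .add (.read 5 arcL) excessL))
      (.seq (.set 3 (scalar 10) (.read 2 (scalar 10))) next))

/-- Advance the current arc of the left node in position `p`. -/
def scanL : Cmd := .set 8 (scalar 10) (addOne arcL)

/-- Raise the left node in position `p` by one and restart its scan. -/
def relabelL : Cmd :=
  .seq (.set 6 (scalar 10) (addOne (.read 6 (scalar 10)))) (.set 8 (scalar 10) (.const 0))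

/-- The step at a left node. -/
def stepL : Cmd :=
  .cond (.op .lt (.read 3 (scalar 10)) (.read 2 (scalar 10)))
    (.cond (.op .lt (.read 6 (scalar 10)) (.op .add (.op .mul (.const 2) (scalar 0)) (.const 2)))
      (.cond (.op .lt arcL (scalar 0))
        (.cond (.read 1 (index (scalar 10) arcL))
          (.cond (.op .eq (.read 6 (scalar 10)) (addOne (.read 7 arcL))) pushL scanL)
          scanL)
        relabelL)
      next)
    next

/-- The excess of the right node in position `p`. -/
def excessR : Term := .op .sub (.read 5 rightNode) (.read 2 rightNode)

/-- The current arc of the right node in position `p`. -/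
def arcR : Term := .read 9 rightNode

/-- The flow on the current arc of the right node in position `p`. -/
def flowR : Term := .read 4 (index arcR rightNode)

/-- Advance the current arc of the right node in position `p`. -/
def scanR : Cmd := .set 9 rightNode (addOne arcR)

/-- Return all the flow on the current arc of the right node in position `p`, which keeps excess.
The array of the current arcs is written last, since the other writes refer to it. -/
def pushRSat : Cmd :=
  .seq (.set 3 arcR (.op .sub (.read 3 arcR) flowR))
    (.seq (.set 5 rightNode (.op .sub (.read 5 rightNode) flowR))
      (.seq (.set 4 (index arcR rightNode) (.const 0)) scanR))

/-- Return the whole excess of the right node in position `p` along its current arc. -/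
def pushREnd : Cmd :=
  .seq (.set 4 (index arcR rightNode) (.op .sub flowR excessR))
    (.seq (.set 3 arcR (.op .sub (.read 3 arcR) excessR))
      (.seq (.set 5 rightNode (.read 2 rightNode)) next))

/-- Raise the right node in position `p` by one and restart its scan. -/
def relabelR : Cmd :=
  .seq (.set 7 rightNode (addOne (.read 7 rightNode))) (.set 9 rightNode (.const 0))

/-- The step at a right node. -/
def stepR : Cmd :=
  .cond (.op .lt (.read 2 rightNode) (.read 5 rightNode))
    (.cond (.op .lt arcR (scalar 0))
      (.cond flowR
        (.cond (.op .eq (.read 7 rightNode) (addOne (.read 6 arcR)))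
          (.cond (.op .lt flowR excessR) pushRSat pushREnd)
          scanR)
        scanR)
      relabelR)
    next

/-- One step of the algorithm. -/
def step : Cmd :=
  .cond (.op .lt (scalar 10) (scalar 0)) stepL
    (.cond (.op .lt (scalar 10) (.op .mul (.const 2) (scalar 0))) stepR
      (.set 10 (.const 0) (.const 0)))

/-- There are iterations left. -/
def guard : Term :=
  .op .lt (scalar 11) (.op .mul (.const 60) (.op .mul (scalar 0) (.op .mul (scalar 0) (scalar 0))))

/-- One iteration of the main loop. -/
def body : Cmd := .seq (.set 11 (.const 0) (addOne (scalar 11))) step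

/-- The push-relabel algorithm as a program: `60 * q ^ 3` elementary steps. Array `3` holds the row
sums of the preflow, which are the output, array `4` the preflow row by row, array `5` its column
sums, the arrays `6` and `7` the heights and the arrays `8` and `9` the current arcs of the left
and the right nodes. All of them start from zero. -/
def program : Cmd := .loop guard body

/-- The bound `60` is the constant in `guard`; it bounds the costs of the expressions as well. -/
theorem small_program : program.Small 60 := by
  simp [program, guard, body, step, stepL, stepR, pushL, scanL, relabelL, pushRSat, pushREnd, scanR,
    relabelR, next, excessL, excessR, flowR, arcL, arcR, rightNode, index, scalar, addOne,
    Cmd.Small, Term.cost, Term.maxConst]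

/-- The state of the algorithm that is stored in a memory. -/
def state (q : ℕ) (s : Mem) : PushState q where
  φ i j := s 4 (i * q + j)
  y i := s 3 i
  c j := s 5 j
  hL i := s 6 i
  hR j := s 7 j
  cL i := s 8 i
  cR j := s 9 j
  p := s 10 0

variable {q : ℕ}

theorem update_val (f : ℕ → ℕ) (i : Fin q) (v : ℕ) :
    (fun a : Fin q => Function.update f i.val v a) = Function.update (fun a : Fin q => f a) i v := by
  ext a
  simp [Function.update_apply, Fin.ext_iff]

theorem update_index (f : ℕ → ℕ) (i j : Fin q) (v : ℕ) :
    (fun a b : Fin q => Function.update f (i * q + j) v (a * q + b)) =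
      Function.update (fun a b : Fin q => f (a * q + b)) i
        (Function.update (fun b : Fin q => f (i * q + b)) j v) := by
  ext a b
  rw [PushState.update_update_apply (fun a b : Fin q => f (a * q + b)), Function.update_apply]
  refine if_congr ⟨fun h => ?_, fun h => by rw [h.1, h.2]⟩ rfl rfl
  have hq : 0 < q := a.pos
  have h1 : (a : ℕ) = i := by
    have := congrArg (· / q) h
    simpa [Nat.add_div_of_dvd_right, Nat.mul_div_cancel _ hq,
      Nat.div_eq_of_lt a.2, Nat.div_eq_of_lt b.2, Nat.div_eq_of_lt j.2] using this
  refine ⟨Fin.ext h1, Fin.ext ?_⟩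
  rw [h1] at h
  omega

theorem state_write_y (s : Mem) (i : Fin q) (v : ℕ) : state q (s.write 3 i v) =
    { state q s with y := Function.update (state q s).y i v } := by
  simp [state, Mem.write_self, Mem.write_of_ne, update_val]

theorem state_write_φ (s : Mem) (i j : Fin q) (v : ℕ) : state q (s.write 4 (i * q + j) v) =
    { state q s with
      φ := Function.update (state q s).φ i (Function.update ((state q s).φ i) j v) } := by
  simp [state, Mem.write_self, Mem.write_of_ne, update_index]

theorem state_write_c (s : Mem) (i : Fin q) (v : ℕ) : state q (s.write 5 i v) =
    { state q s with c := Function.update (state q s).c i v } := by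
  simp [state, Mem.write_self, Mem.write_of_ne, update_val]

theorem state_write_hL (s : Mem) (i : Fin q) (v : ℕ) : state q (s.write 6 i v) =
    { state q s with hL := Function.update (state q s).hL i v } := by
  simp [state, Mem.write_self, Mem.write_of_ne, update_val]

theorem state_write_hR (s : Mem) (i : Fin q) (v : ℕ) : state q (s.write 7 i v) =
    { state q s with hR := Function.update (state q s).hR i v } := by
  simp [state, Mem.write_self, Mem.write_of_ne, update_val]

theorem state_write_cL (s : Mem) (i : Fin q) (v : ℕ) : state q (s.write 8 i v) =
    { state q s with cL := Function.update (state q s).cL i v } := by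
  simp [state, Mem.write_self, Mem.write_of_ne, update_val]

theorem state_write_cR (s : Mem) (i : Fin q) (v : ℕ) : state q (s.write 9 i v) =
    { state q s with cR := Function.update (state q s).cR i v } := by
  simp [state, Mem.write_self, Mem.write_of_ne, update_val]

theorem state_write_p (s : Mem) (v : ℕ) : state q (s.write 10 0 v) =
    { state q s with p := v } := by
  simp [state, Mem.write_self, Mem.write_of_ne]

theorem state_write_clock (s : Mem) (i v : ℕ) : state q (s.write 11 i v) = state q s := by
  simp [state, Mem.write_of_ne]

/-- The three input arrays are untouched. -/
def HasInput (S : LoopGraph (Fin q)) (x : Fin q → ℕ) (s : Mem) : Prop :=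
  ∀ a < 3, s a = input S x a

theorem HasInput.write {S : LoopGraph (Fin q)} {x : Fin q → ℕ} {s : Mem} (h : HasInput S x s)
    {a : ℕ} (ha : 3 ≤ a) (i v : ℕ) : HasInput S x (s.write a i v) := fun c hc => by
  rw [Mem.write_of_ne _ (by omega), h c hc]

theorem HasInput.nodes {S : LoopGraph (Fin q)} {x : Fin q → ℕ} {s : Mem} (h : HasInput S x s) :
    s 0 0 = q := by
  rw [h 0 (by norm_num)]
  simp [input]

theorem HasInput.vector {S : LoopGraph (Fin q)} {x : Fin q → ℕ} {s : Mem} (h : HasInput S x s)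
    (i : Fin q) : s 2 i = x i := by
  rw [h 2 (by norm_num)]
  simp [input]

theorem HasInput.matrix {S : LoopGraph (Fin q)} {x : Fin q → ℕ} {s : Mem} (h : HasInput S x s)
    (i j : Fin q) : s 1 (i * q + j) = 0 ↔ s(i, j) ∉ S.edges := by
  rw [h 1 (by norm_num)]
  simp only [input]
  split_ifs with hex
  · obtain ⟨a, b, hab, hS⟩ := hex
    have hq : 0 < q := a.pos
    have h1 : (i : ℕ) = a := by
      have := congrArg (· / q) hab
      simpa [Nat.add_div_of_dvd_right, Nat.mul_div_cancel _ hq, Nat.div_eq_of_lt j.2,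
        Nat.div_eq_of_lt b.2] using this
    have h2 : (j : ℕ) = b := by rw [h1] at hab; omega
    rw [Fin.ext h1, Fin.ext h2]
    simpa using hS
  · simp only [true_iff]
    exact fun hS => hex ⟨i, j, rfl, hS⟩

theorem eval_add (m n : ℕ) : Op.eval .add m n = m + n := rfl

theorem eval_mul (m n : ℕ) : Op.eval .mul m n = m * n := rfl

theorem eval_lt_ne_zero (m n : ℕ) : Op.eval .lt m n ≠ 0 ↔ m < n := by simp [Op.eval]

theorem eval_lt_eq_zero (m n : ℕ) : Op.eval .lt m n = 0 ↔ ¬ m < n := by simp [Op.eval]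

theorem eval_eq_ne_zero (m n : ℕ) : Op.eval .eq m n ≠ 0 ↔ m = n := by simp [Op.eval]

theorem eval_eq_eq_zero (m n : ℕ) : Op.eval .eq m n = 0 ↔ ¬ m = n := by simp [Op.eval]

/-- One step of the program realizes one step of the algorithm, and writes only small numbers. -/
theorem wp_step {S : LoopGraph (Fin q)} {x : Fin q → ℕ} {b : ℕ} {s : Mem} (hin : HasInput S x s)
    (hinv : (state q s).Inv S x) (hb : 4 * (q + ∑ i, x i) + 4 ≤ b) (hs : ∀ a n, s a n ≤ b) :
    step.wp b s fun s' => HasInput S x s' ∧ s' 11 0 = s 11 0 ∧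
      (state q s).Step S x (state q s') := by
  have hq := hin.nodes
  have hp : s 10 0 ≤ 2 * q := hinv.p_le
  have hx : ∀ i, x i ≤ ∑ i, x i := fun i =>
    Finset.single_le_sum (f := x) (fun _ _ => Nat.zero_le _) (Finset.mem_univ i)
  have hcur : ∀ i, s 8 (Fin.val (n := q) i) ≤ q := hinv.cL_le
  have hcur' : ∀ i, s 9 (Fin.val (n := q) i) ≤ q := hinv.cR_le
  have hy : ∀ i, s 3 (Fin.val (n := q) i) ≤ x i := hinv.y_le
  simp only [step, Cmd.wp, Term.eval, scalar, eval_mul, eval_lt_ne_zero, eval_lt_eq_zero, hq]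
  refine ⟨fun h1 => ?_, fun h1 => ⟨fun h2 => ?_, fun h2 => ⟨Nat.zero_le _,
    hin.write (by norm_num) _ _, rfl, ?_⟩⟩⟩
  · obtain ⟨i, hi⟩ : ∃ i : Fin q, s 10 0 = i := ⟨⟨_, h1⟩, rfl⟩
    have hnext : ¬ (state q s).ActiveL x i → next.wp b s fun s' => HasInput S x s' ∧
        s' 11 0 = s 11 0 ∧ (state q s).Step S x (state q s') := fun ha => by
      refine ⟨?_, hin.write (by norm_num) _ _, rfl, ?_⟩
      · simp only [addOne, scalar, Term.eval, Op.eval]; omega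
      · simp only [Term.eval, state_write_p]
        exact .skipL i hi ha
    have hscan : ∀ j : Fin q, (state q s).ActiveL x i → s 8 i = j →
        (s(i, j) ∈ S.edges → s 6 i ≠ s 7 j + 1) → scanL.wp b s fun s' => HasInput S x s' ∧
        s' 11 0 = s 11 0 ∧ (state q s).Step S x (state q s') := fun j ha hj hn => by
      refine ⟨?_, hin.write (by norm_num) _ _, rfl, ?_⟩
      · simp only [addOne, arcL, scalar, Term.eval, Op.eval, hi]
        have := hcur i; omega
      · simp only [Term.eval, scalar, addOne, arcL, hi, state_write_cL]
        exact .scanL i j hi ha hj hn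
    simp only [stepL, Cmd.wp, Term.eval, scalar, arcL, index, addOne, eval_lt_ne_zero,
      eval_lt_eq_zero, eval_eq_ne_zero, eval_eq_eq_zero, eval_add, eval_mul, hq, hi, hin.vector]
    refine ⟨fun ha1 => ⟨fun ha2 => ?_, fun ha2 => hnext fun ha => ha2 ha.2⟩,
      fun ha1 => hnext fun ha => ha1 ha.1⟩
    have ha : (state q s).ActiveL x i := ⟨ha1, ha2⟩
    refine ⟨fun hc => ?_, fun hc => ?_⟩
    · obtain ⟨j, hj⟩ : ∃ j : Fin q, s 8 i = j := ⟨⟨_, hc⟩, rfl⟩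
      simp only [hj, ne_eq, hin.matrix, not_not]
      refine ⟨fun hS => ⟨fun hh => ?_, fun hh => hscan j ha hj fun _ => hh⟩,
        fun hS => hscan j ha hj fun h => absurd h hS⟩
      have hstep := PushState.Step.pushL (S := S) (x := x) (σ := state q s) i j hi ha hj hS hh
      have hinv' := hinv.step hstep
      have hφ := (hinv'.le_y i j).trans (hinv'.y_le i)
      have hc := hinv'.c_le j
      simp only [PushState.update_update_apply, Function.update_self, and_self, if_true] at hφ hc
      simp only [pushL, Cmd.wp, Term.eval, scalar, arcL, index, excessL, next, addOne, Op.eval, hq, hi,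
        hj, hin.vector, Mem.write_of_ne _ (show 2 ≠ 4 by norm_num),
        Mem.write_of_ne _ (show 2 ≠ 5 by norm_num), Mem.write_of_ne _ (show 3 ≠ 4 by norm_num),
        Mem.write_of_ne _ (show 5 ≠ 4 by norm_num), Mem.write_of_ne _ (show 8 ≠ 4 by norm_num),
        Mem.write_of_ne _ (show 10 ≠ 4 by norm_num), Mem.write_of_ne _ (show 10 ≠ 5 by norm_num),
        Mem.write_of_ne _ (show 10 ≠ 3 by norm_num)]
      refine ⟨?_, ?_, ?_, ?_, ?_, rfl, ?_⟩
      · exact hφ.trans ((hx i).trans (by omega))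
      · exact hc.trans (by omega)
      · exact (hx i).trans (by omega)
      · omega
      · exact (((hin.write (by norm_num) _ _).write (by norm_num) _ _).write (by norm_num) _ _).write
          (by norm_num) _ _
      · simp only [state_write_p, state_write_y, state_write_c, state_write_φ]
        rw [show i.val + 1 = (state q s).p + 1 from congrArg (· + 1) hi.symm]
        exact hstep
    · simp only [relabelL, Cmd.wp, Term.eval, scalar, addOne, Op.eval, hi,
        Mem.write_of_ne _ (show 10 ≠ 6 by norm_num)]
      refine ⟨by omega, Nat.zero_le _, (hin.write (by norm_num) _ _).write (by norm_num) _ _, rfl, ?_⟩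
      simp only [state_write_hL, state_write_cL]
      exact .relabelL i hi ha (not_lt.1 hc)
  · obtain ⟨j, hj⟩ : ∃ j : Fin q, s 10 0 = q + j :=
      ⟨⟨s 10 0 - q, by omega⟩, by dsimp only; omega⟩
    have hnode : q + j.val - q = j.val := Nat.add_sub_cancel_left ..
    have hnext : ¬ (state q s).ActiveR x j → next.wp b s fun s' => HasInput S x s' ∧
        s' 11 0 = s 11 0 ∧ (state q s).Step S x (state q s') := fun ha => by
      refine ⟨?_, hin.write (by norm_num) _ _, rfl, ?_⟩
      · simp only [addOne, scalar, Term.eval, Op.eval]; omega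
      · simp only [Term.eval, state_write_p]
        exact .skipR j hj ha
    have hscan : ∀ k : Fin q, (state q s).ActiveR x j → s 9 j = k →
        (0 < s 4 (k * q + j) → s 7 j ≠ s 6 k + 1) → scanR.wp b s fun s' => HasInput S x s' ∧
        s' 11 0 = s 11 0 ∧ (state q s).Step S x (state q s') := fun k ha hk hn => by
      refine ⟨?_, hin.write (by norm_num) _ _, rfl, ?_⟩
      · simp only [addOne, arcR, rightNode, scalar, Term.eval, Op.eval, hq, hj, hnode]
        have := hcur' j; omega
      · simp only [Term.eval, rightNode, scalar, addOne, arcR, Op.eval, hq, hj, hnode, state_write_cR]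
        exact .scanR j k hj ha hk hn
    simp only [stepR, Cmd.wp, Term.eval, rightNode, scalar, arcR, flowR, excessR, index, addOne,
      eval_lt_ne_zero, eval_lt_eq_zero, eval_eq_ne_zero, eval_eq_eq_zero, hq, hj]
    simp only [Op.eval, hnode, hin.vector]
    refine ⟨fun ha => ⟨fun hc => ?_, fun hc => ?_⟩, hnext⟩
    · have ha : (state q s).ActiveR x j := ha
      obtain ⟨k, hk⟩ : ∃ k : Fin q, s 9 j = k := ⟨⟨_, hc⟩, rfl⟩
      simp only [hk]
      refine ⟨fun hφ => ⟨fun hh => ⟨fun hlt => ?_, fun hle => ?_⟩, fun hh => hscan k ha hk fun _ => hh⟩,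
        fun hφ => hscan k ha hk fun h => absurd hφ h.ne'⟩
      · simp only [pushRSat, scanR, Cmd.wp, Term.eval, rightNode, scalar, arcR, flowR, index, addOne,
          Op.eval, hq, hj, hk, hnode, Mem.write_of_ne _ (show 4 ≠ 3 by norm_num),
          Mem.write_of_ne _ (show 0 ≠ 3 by norm_num), Mem.write_of_ne _ (show 0 ≠ 4 by norm_num),
          Mem.write_of_ne _ (show 0 ≠ 5 by norm_num), Mem.write_of_ne _ (show 5 ≠ 3 by norm_num),
          Mem.write_of_ne _ (show 9 ≠ 3 by norm_num), Mem.write_of_ne _ (show 9 ≠ 4 by norm_num),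
          Mem.write_of_ne _ (show 9 ≠ 5 by norm_num), Mem.write_of_ne _ (show 10 ≠ 3 by norm_num),
          Mem.write_of_ne _ (show 10 ≠ 4 by norm_num), Mem.write_of_ne _ (show 10 ≠ 5 by norm_num)]
        refine ⟨(Nat.sub_le _ _).trans (hs _ _), (Nat.sub_le _ _).trans (hs _ _), Nat.zero_le _,
          by omega, ?_, rfl, ?_⟩
        · exact (((hin.write (by norm_num) _ _).write (by norm_num) _ _).write
            (by norm_num) _ _).write (by norm_num) _ _
        · simp only [state_write_cR, state_write_y, state_write_c, state_write_φ]
          rw [show k.val + 1 = (state q s).cR j + 1 from congrArg (· + 1) hk.symm]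
          exact .pushRSat j k hj ha hk (Nat.pos_of_ne_zero hφ) hh hlt
      · simp only [pushREnd, next, Cmd.wp, Term.eval, rightNode, scalar, arcR, flowR, excessR, index,
          addOne, Op.eval, hq, hj, hk, hnode, hin.vector, Mem.write_of_ne _ (show 2 ≠ 4 by norm_num),
          Mem.write_of_ne _ (show 2 ≠ 3 by norm_num), Mem.write_of_ne _ (show 3 ≠ 4 by norm_num),
          Mem.write_of_ne _ (show 0 ≠ 3 by norm_num), Mem.write_of_ne _ (show 0 ≠ 4 by norm_num),
          Mem.write_of_ne _ (show 5 ≠ 4 by norm_num), Mem.write_of_ne _ (show 9 ≠ 4 by norm_num),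
          Mem.write_of_ne _ (show 10 ≠ 3 by norm_num), Mem.write_of_ne _ (show 10 ≠ 4 by norm_num),
          Mem.write_of_ne _ (show 10 ≠ 5 by norm_num)]
        refine ⟨(Nat.sub_le _ _).trans (hs _ _), (Nat.sub_le _ _).trans (hs _ _),
          (hx j).trans (by omega), by omega, ?_, rfl, ?_⟩
        · exact (((hin.write (by norm_num) _ _).write (by norm_num) _ _).write
            (by norm_num) _ _).write (by norm_num) _ _
        · simp only [state_write_p, state_write_y, state_write_c, state_write_φ]
          rw [show q + j.val + 1 = (state q s).p + 1 from congrArg (· + 1) hj.symm]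
          exact .pushREnd j k hj ha hk hh (not_lt.1 hle)
    · simp only [relabelR, Cmd.wp, Term.eval, rightNode, scalar, addOne, Op.eval, hq, hj, hnode,
        Mem.write_of_ne _ (show 10 ≠ 7 by norm_num), Mem.write_of_ne _ (show 0 ≠ 7 by norm_num)]
      have hstep := PushState.Step.relabelR (S := S) (x := x) (σ := state q s) j hj ha (not_lt.1 hc)
      have hh := (hinv.step hstep).hR_le j
      simp only [Function.update_self] at hh
      have hpos := j.pos
      refine ⟨hh.trans (by omega), Nat.zero_le _,
        (hin.write (by norm_num) _ _).write (by norm_num) _ _, rfl, ?_⟩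
      simp only [state_write_hR, state_write_cR]
      exact hstep
  · simp only [state_write_p]
    exact .wrap (le_antisymm hp (by dsimp only [state]; omega))

end Ram.PushRelabel

/-! ### Correctness of the program -/

theorem Ram.Cmd.wp_mono {b : ℕ} {Q Q' : Ram.Mem → Prop} (h : ∀ s, Q s → Q' s) (c : Ram.Cmd) :
    ∀ s, c.wp b s Q → c.wp b s Q' := by
  induction c generalizing Q Q' with
  | skip => exact h
  | set a i e => exact fun s hs => ⟨hs.1, h _ hs.2⟩
  | seq c₁ c₂ ih₁ ih₂ => exact ih₁ fun s => ih₂ h s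
  | cond e c₁ c₂ ih₁ ih₂ => exact fun s hs => ⟨fun he => ih₁ h s (hs.1 he), fun he => ih₂ h s (hs.2 he)⟩
  | loop e c _ => exact fun s hs => hs

namespace Ram.PushRelabel

variable {q : ℕ}

theorem inv_state_input (S : LoopGraph (Fin q)) (x : Fin q → ℕ) :
    (state q (input S x)).Inv S x := by
  constructor <;> simp [state, input]

theorem input_le {S : LoopGraph (Fin q)} {x : Fin q → ℕ} (hq : 1 ≤ q) (a n : ℕ) :
    input S x a n ≤ q + ∑ i, x i := by
  match a with
  | 0 => simp only [input]; split_ifs <;> omega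
  | 1 => simp only [input]; split_ifs <;> omega
  | 2 =>
    simp only [input]
    split_ifs
    · exact le_trans (Finset.single_le_sum (f := x) (fun _ _ => Nat.zero_le _) (Finset.mem_univ _))
        (Nat.le_add_left _ _)
    · omega
  | a + 3 => exact Nat.zero_le _

/-- `100 * n ^ 3` bounds all the numbers that the program stores, and the sixtieth power of it those
that occur in the evaluation of its expressions. -/
theorem pow_le_pow_of_two_le {n : ℕ} (hn : 2 ≤ n) : (100 * n ^ 3) ^ 60 ≤ n ^ 600 := by
  have h7 : 100 ≤ n ^ 7 := le_trans (by norm_num) (Nat.pow_le_pow_left hn 7)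
  have h10 : 100 * n ^ 3 ≤ n ^ 10 := by
    rw [show n ^ 10 = n ^ 7 * n ^ 3 from pow_add n 7 3]
    exact Nat.mul_le_mul_right _ h7
  calc (100 * n ^ 3) ^ 60 ≤ (n ^ 10) ^ 60 := Nat.pow_le_pow_left h10 60
    _ = n ^ 600 := by rw [← pow_mul]

/-- While the algorithm is active, each iteration lowers the potential, which is less than
`60 * q ^ 3` at the start; so the algorithm is idle at the end of the loop. -/
theorem exists_runs_program {S : LoopGraph (Fin q)} {x : Fin q → ℕ} (hq : 1 ≤ q)
    (hx : ∀ i, 0 < x i) :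
    ∃ t s, Runs ((q + ∑ i, x i) ^ 600) program (input S x) t s ∧
      t ≤ 61 * (guard.cost + 1 + body.cost) * q ^ 3 ∧
      (fun i => (output q s i : ℝ)) ∈ S.lpSolutions x := by
  set n := q + ∑ i, x i with hn
  have hn2 : 2 ≤ n := by
    have := Finset.single_le_sum (f := x) (fun _ _ => Nat.zero_le _) (Finset.mem_univ ⟨0, hq⟩)
    have := hx ⟨0, hq⟩
    omega
  have hn3 : n ≤ n ^ 3 := Nat.le_self_pow (by norm_num) n
  have hqn : q ^ 3 ≤ n ^ 3 := Nat.pow_le_pow_left (Nat.le_add_right _ _) 3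
  have hB := pow_le_pow_of_two_le hn2
  have hcube : q * (q * q) = q ^ 3 := by ring
  let I : ℕ → Mem → Prop := fun k s => HasInput S x s ∧ s 11 0 = k ∧ (state q s).Inv S x ∧
    ((state q s).Idle x ∨ ∃ M, (state q s).Top x M ∧
      (state q s).potential M + k ≤ (state q (input S x)).potential 0)
  have hguard : ∀ k s, I k s → guard.eval s = Op.eval .lt k (60 * q ^ 3) := by
    rintro k s ⟨h1, h2, -⟩
    simp only [guard, scalar, Term.eval, h1.nodes, h2, eval_mul, hcube]
  have hstep : ∀ k s, k < 60 * q ^ 3 → (∀ a m, s a m ≤ 100 * n ^ 3) → I k s →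
      guard.eval s ≠ 0 ∧ body.wp (100 * n ^ 3) s (I (k + 1)) := by
    intro k s hk hs hI
    refine ⟨by rw [hguard k s hI, eval_lt_ne_zero]; exact hk, ?_⟩
    obtain ⟨hin, hclock, hinv, hpot⟩ := hI
    have hval : (addOne (scalar 11)).eval s = k + 1 := by
      simp only [addOne, scalar, Term.eval, hclock, eval_add]
    refine ⟨by rw [hval]; omega, ?_⟩
    rw [hval]
    simp only [Term.eval]
    have hwp := wp_step (s := s.write 11 0 (k + 1)) (hin.write (by norm_num) _ _)
      (by rwa [state_write_clock]) (show 4 * (q + ∑ i, x i) + 4 ≤ 100 * n ^ 3 by omega)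
      (Mem.write_le hs (by omega))
    refine Cmd.wp_mono ?_ _ _ hwp
    rintro s' ⟨hin', hclock', hstep⟩
    rw [state_write_clock] at hstep
    refine ⟨hin', hclock'.trans (by simp [Mem.write_self]), hinv.step hstep, ?_⟩
    rcases hpot with hidle | ⟨M, hM, hle⟩
    · exact Or.inl (hidle.step hstep)
    · rcases hinv.step_potential hstep hM with hidle | ⟨M', hM', hle'⟩
      · exact Or.inl hidle
      · refine Or.inr ⟨M', hM', ?_⟩
        push_cast
        linarith
  have hend : ∀ s, I (60 * q ^ 3) s → guard.eval s = 0 := by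
    intro s hI
    rw [hguard _ s hI]
    simp [Op.eval]
  have hbound : ∀ a m, input S x a m ≤ 100 * n ^ 3 :=
    fun a m => (input_le hq a m).trans (by omega)
  have hinit : I 0 (input S x) := by
    refine ⟨fun _ _ => rfl, rfl, inv_state_input S x, Or.inr ⟨0, ⟨fun i _ => ?_, fun j _ => ?_⟩, ?_⟩⟩
    · simp [state, input]
    · simp [state, input]
    · simp
  obtain ⟨t, s, hrun, ht, hs⟩ := Cmd.exists_runs_loop (b := 100 * n ^ 3) (K := 60)
    (B := n ^ 600) (e := guard) (c := body) (N := 60 * q ^ 3) (s := input S x)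
    (by omega) (by omega) hB small_program I hstep hend hbound hinit
  refine ⟨t, s, hrun, ht.trans ?_, ?_⟩
  · have hq3 : 1 ≤ q ^ 3 := Nat.one_le_pow _ _ hq
    calc (60 * q ^ 3 + 1) * (guard.cost + 1 + body.cost)
        ≤ (61 * q ^ 3) * (guard.cost + 1 + body.cost) := Nat.mul_le_mul_right _ (by omega)
      _ = _ := by ring
  · obtain ⟨-, -, hinv, hidle⟩ := hs
    refine hinv.mem_lpSolutions (hidle.resolve_right ?_)
    rintro ⟨M, -, hM⟩
    have h0 := hinv.potential_nonneg M
    have h1 : (state q (input S x)).potential 0 =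
        2 * q * (2 * q + 3) * (2 * q + 1) + 2 * q + 2 * q * (2 * q + 3) * (q + 1) + 2 * q * q := by
      simp [PushState.potential, PushState.heightSum, PushState.curSum, state, input]
    rw [h1] at hM
    have hq' : (1 : ℤ) ≤ q := by exact_mod_cast hq
    push_cast at hM
    nlinarith [mul_nonneg (sub_nonneg.2 hq') (sub_nonneg.2 hq'), pow_nonneg (sub_nonneg.2 hq') 3]

end Ram.PushRelabel

theorem theorem1 :
    -- every extremal solution is integer valued
    (∀ (q : ℕ) (S : LoopGraph (Fin q)) (x : Fin q → ℕ), (∀ i, 0 < x i) →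
      ∀ y ∈ Set.extremePoints ℝ (S.lpSolutions x), ∀ i, ∃ n : ℤ, y i = (n : ℝ)) ∧
    -- one program computes an integer solution in time `O(q ^ 3)`, with words of
    -- `O(log (q + ∑ i, x i))` bits
    (∃ (P : Ram.Cmd) (C k : ℕ), ∀ (q : ℕ) (S : LoopGraph (Fin q)) (x : Fin q → ℕ),
      1 ≤ q → (∀ i, 0 < x i) →
        ∃ (t : ℕ) (s : Ram.Mem),
          Ram.Runs ((q + ∑ i, x i) ^ k) P (Ram.input S x) t s ∧ t ≤ C * q ^ 3 ∧
          (fun i => (Ram.output q s i : ℝ)) ∈ S.lpSolutions x) ∧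
    -- cycle covers of `K_y` and largest 2-regular subgraphs of `K_x`
    (∀ (q : ℕ) (S : LoopGraph (Fin q)) (x : Fin q → ℕ), (∀ i, 3 ≤ x i) →
      ∀ (y : Fin q → ℕ) (hy : (fun i => (y i : ℝ)) ∈ S.lpSolutions x),
        (∃ H : (S.completePartite y).Subgraph, H.IsSpanning ∧
          ∃ k ≤ q, H.IsDisjointUnionOfCycles k) ∧
        ∀ H : (S.completePartite y).Subgraph, H.IsSpanning → H.IsTwoRegular →
          (H.map (S.inclusion (LoopGraph.le_of_mem_lpSolutions hy))).IsLargestTwoRegular) := by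
  refine ⟨fun q S x _ y hy i => LoopGraph.exists_int_of_mem_extremePoints hy i,
    ⟨Ram.PushRelabel.program, _, 600, fun q S x hq hx => Ram.PushRelabel.exists_runs_program hq hx⟩,
    fun q S x hx y hy => ⟨LoopGraph.exists_spanning_isDisjointUnionOfCycles hx hy,
      fun H hspan hH => LoopGraph.isLargestTwoRegular_map hy hspan hH⟩⟩
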